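/- **Model.** For each sample size $T$ consider $y = X\beta_0 + u$ with $X\in\mathbb{R}^{T\times p}$, $\|\beta_0\|_0 = s$ (the number of nonzero entries), and $$X = R_X^{1/2} Z_X \Sigma_X^{1/2},\qquad u = \sigma_u R_u^{1/2} z_u ,$$ where $p$, $s$, $\beta_0$ and the matrices may depend on $T$. For each $i$, the products $(x_{ti}u_t)_{t=1}^T$ form a martingale difference sequence with respect to some filtration. For a penalty function $p_\lambda$ put $Q_T(\beta) = (2T)^{-1}\|y-X\beta\|_2^2 + \sum_{j=1}^p p_\lambda(|\beta_j|)$. **Dimensionality.** There are constants $\phi,\phi_0,\delta,\delta_0>0$ with $\delta+\delta_0<1$ and $\phi^2<1/2$ such that $p = e^{\phi T^\delta}$ and $s = \phi_0 T^{\delta_0}$ up to rounding to an integer (that is, $|p-e^{\phi T^\delta}|<1$ and $|s-\phi_0T^{\delta_0}|<1$), and $m = m_T$ are integers with $2s\le m\le \phi T^{1-\delta}$. **Gaussian design.** The entries of $Z_X\in\mathbb{R}^{T\times p}$ and $z_u\in\mathbb{R}^T$ are jointly i.i.d. $N(0,1)$. The non-random matrices $R_X$, $R_u$, $\Sigma_X$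 are symmetric positive definite with smallest eigenvalues bounded below by constants $c_{R_X}, c_{R_u}, c_\Sigma>0$ not depending on $T$, and $\sigma_u>0$ is a constant. $R_X^{1/2}=(r^{(X)}_{st})$ and $R_u^{1/2}=(r^{(u)}_{st})$ are lower triangular with unit diagonal and $R_X = R_X^{1/2}(R_X^{1/2})^\top$, $R_u = R_u^{1/2}(R_u^{1/2})^\top$; $\Sigma_X^{1/2} = (\sigma_{ij})$ is positive definite with unit diagonal and $(\Sigma_X^{1/2})^\top\Sigma_X^{1/2}=\Sigma_X$. The sums $R^{(X)}_{sT}=\sum_t (r^{(X)}_{st})^2$, $R^{(u)}_{sT}=\sum_t (r^{(u)}_{st})^2$ and $\Sigma_{pj}=\sum_i \sigma_{ij}^2$ are bounded uniformly in all indices. Put $c_R = \min(c_{R_X},c_{R_u})$, $\gamma = c_\Sigma c_R/9$ and $c_{xu}=\limsup_T\max_{t,i}\{R^{(X)}_{tT}\Sigma_{pi},\, R^{(u)}_{tT}\sigma_u\}<\infty$. **Penalty.** Let $\lambda = c_0\log(pT)(\log p/T)^{1/2}$ with a constant $c_0>0$ such that $c_0\ge 16c_{xu}$. On $[0,\infty)$,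 $p_\lambda$ is concave and nondecreasing with $p_\lambda(0)=0$; $v\mapsto p_\lambda(v)/v$ is nonincreasing on $(0,\infty)$; $p_\lambda$ has a continuous derivative on $(0,\infty)$ with $p_\lambda'(0+)=\lambda$; and $v\mapsto p_\lambda(v)+\mu v^2/2$ is convex on $[0,\infty)$ for a constant $\mu>0$ not depending on $T$. Assume $\mu<2\gamma$. **Conclusion.** For all sufficiently large $T$ there is a (measurable) local minimizer $\hat\beta$ of $Q_T$ on the set $\{\beta\in\mathbb{R}^p:\|\beta\|_0\le m-s\}$ (local minimality being relative to this set) such that, with probability at least $1-6p^{-1}-2\exp\{-(1/2-\phi^2)T\}$, the following hold simultaneously: (a) $\|\hat\beta-\beta_0\|_2\le \dfrac{6s^{1/2}\lambda}{2\gamma-\mu}$; (b) $\|\hat\beta-\beta_0\|_1\le \dfrac{24 s\lambda}{2\gamma-\mu}$; (c) $T^{-1/2}\|X(\hat\beta-\beta_0)\|_2\le \dfrac{9 s^{1/2}\lambda}{(2\gamma-\mu)^{1/2}}$. -/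

import Mathlib

open MeasureTheory ProbabilityTheory Filter Topology Matrix

noncomputable section

namespace PenalizedTS

/-- The number of nonzero entries of a vector. -/
def l0 {p : ℕ} (v : Fin p → ℝ) : ℕ := (Finset.univ.filter fun j => v j ≠ 0).card

/-- The `ℓ₁` norm of a vector. -/
def l1 {ι : Type*} [Fintype ι] (v : ι → ℝ) : ℝ := ∑ j, |v j|

/-- The `ℓ₂` (Euclidean) norm of a vector. -/
def l2 {ι : Type*} [Fintype ι] (v : ι → ℝ) : ℝ := Real.sqrt (∑ j, v j ^ 2)

/-- `q = p_λ` (only its values on `[0, ∞)` matter) is a folded-concave penalty with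
regularization parameter `lam` and convexity constant `μ`. -/
structure IsFoldedConcave (q : ℝ → ℝ) (lam μ : ℝ) : Prop where
  concave : ConcaveOn ℝ (Set.Ici 0) q
  zero : q 0 = 0
  mono : MonotoneOn q (Set.Ici 0)
  ratio_antitone : AntitoneOn (fun v => q v / v) (Set.Ioi 0)
  differentiable : DifferentiableOn ℝ q (Set.Ioi 0)
  deriv_continuous : ContinuousOn (deriv q) (Set.Ioi 0)
  deriv_zero : Tendsto (deriv q) (𝓝[>] 0) (𝓝 lam)
  mu_pos : 0 < μ
  convex_add : ConvexOn ℝ (Set.Ici 0) (fun v => q v + μ * v ^ 2 / 2)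

/-- The ingredients of the regression `y = X β₀ + u` with `T` observations and `p` covariates:
`X = R_X^{1/2} Z Σ_X^{1/2}` and `u = σ_u R_u^{1/2} z`. Their properties are stated separately. -/
structure Model (Ω : Type*) (T p : ℕ) where
  /-- the matrix `R_X^{1/2}` -/
  LX : Matrix (Fin T) (Fin T) ℝ
  /-- the matrix `R_u^{1/2}` -/
  Lu : Matrix (Fin T) (Fin T) ℝ
  /-- the matrix `Σ_X^{1/2}` -/
  S : Matrix (Fin p) (Fin p) ℝ
  /-- the scale `σ_u` of the errors -/
  sigma : ℝ
  /-- the random matrix `Z_X` -/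
  Z : Ω → Matrix (Fin T) (Fin p) ℝ
  /-- the random vector `z_u` -/
  z : Ω → Fin T → ℝ
  /-- the true parameter -/
  beta0 : Fin p → ℝ

namespace Model

variable {Ω : Type*} {T p : ℕ}

/-- `R_X`, with `R_X^{1/2}` as its Cholesky factor. -/
def RX (M : Model Ω T p) : Matrix (Fin T) (Fin T) ℝ := M.LX * M.LXᵀ

/-- `R_u`, with `R_u^{1/2}` as its Cholesky factor. -/
def Ru (M : Model Ω T p) : Matrix (Fin T) (Fin T) ℝ := M.Lu * M.Luᵀ

/-- `Σ_X`, the covariance matrix of the rows of `Z Σ_X^{1/2}`. For a symmetric `Σ_X^{1/2}` it is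
the square of that matrix. -/
def SigmaX (M : Model Ω T p) : Matrix (Fin p) (Fin p) ℝ := M.Sᵀ * M.S

/-- The covariate matrix. -/
def X (M : Model Ω T p) (ω : Ω) : Matrix (Fin T) (Fin p) ℝ := M.LX * M.Z ω * M.S

/-- The error vector. -/
def u (M : Model Ω T p) (ω : Ω) : Fin T → ℝ := M.sigma • (M.Lu *ᵥ M.z ω)

/-- The response vector. -/
def y (M : Model Ω T p) (ω : Ω) : Fin T → ℝ := M.X ω *ᵥ M.beta0 + M.u ω

/-- The penalized least-squares objective `Q_T`, for the penalty function `q = p_λ`. -/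
def Q (M : Model Ω T p) (q : ℝ → ℝ) (ω : Ω) (b : Fin p → ℝ) : ℝ :=
  (2 * (T : ℝ))⁻¹ * l2 (M.y ω - M.X ω *ᵥ b) ^ 2 + ∑ j, |q (|b j|)|

/-- `R_{sT}^{(X)}`, the squared norm of row `t` of `R_X^{1/2}`. -/
def rowX (M : Model Ω T p) (t : Fin T) : ℝ := ∑ r, M.LX t r ^ 2

/-- `R_{sT}^{(u)}`, the squared norm of row `t` of `R_u^{1/2}`. -/
def rowU (M : Model Ω T p) (t : Fin T) : ℝ := ∑ r, M.Lu t r ^ 2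

/-- `Σ_{pj}^{(X)}`, the squared norm of column `j` of `Σ_X^{1/2}`. -/
def colS (M : Model Ω T p) (j : Fin p) : ℝ := ∑ i, M.S i j ^ 2

/-- The maximum over `t` and `i` of `R_{tT}^{(X)} Σ_{pi}` and `R_{tT}^{(u)} σ_u`. -/
def scale (M : Model Ω T p) : ENNReal :=
  ⨆ (t : Fin T) (i : Fin p),
    ENNReal.ofReal (max (M.rowX t * M.colS i) (M.rowU t * M.sigma))

/-- The entries of `Z_X` and `z_u` are (jointly) i.i.d. standard normal random variables. -/
structure IsGaussian [MeasurableSpace Ω] (M : Model Ω T p) (P : Measure Ω) : Prop where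
  measurable_Z : ∀ t i, Measurable fun ω => M.Z ω t i
  measurable_z : ∀ t, Measurable fun ω => M.z ω t
  law_Z : ∀ t i, P.map (fun ω => M.Z ω t i) = gaussianReal 0 1
  law_z : ∀ t, P.map (fun ω => M.z ω t) = gaussianReal 0 1
  indep : iIndepFun
    (fun (k : (Fin T × Fin p) ⊕ Fin T) (ω : Ω) =>
      Sum.elim (fun ti => M.Z ω ti.1 ti.2) (fun t => M.z ω t) k) P

/-- The conditions on the deterministic matrices. The bound `K` on the row and column sums does
not depend on `T` or `p` when the condition is imposed along a sequence of models.
Positive definiteness of `Σ_X^{1/2}` is that of its quadratic form, so that symmetry of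
`Σ_X^{1/2}` is allowed but not needed. -/
structure IsRegular (M : Model Ω T p) (cRX cRu cS K : ℝ) : Prop where
  posDef_RX : M.RX.PosDef
  posDef_Ru : M.Ru.PosDef
  posDef_SigmaX : M.SigmaX.PosDef
  eig_RX : ∀ t, cRX ≤ posDef_RX.isHermitian.eigenvalues t
  eig_Ru : ∀ t, cRu ≤ posDef_Ru.isHermitian.eigenvalues t
  eig_SigmaX : ∀ i, cS ≤ posDef_SigmaX.isHermitian.eigenvalues i
  sigma_pos : 0 < M.sigma
  lower_LX : ∀ s t, s < t → M.LX s t = 0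
  lower_Lu : ∀ s t, s < t → M.Lu s t = 0
  diag_LX : ∀ t, M.LX t t = 1
  diag_Lu : ∀ t, M.Lu t t = 1
  posDef_S : ∀ v : Fin p → ℝ, v ≠ 0 → 0 < v ⬝ᵥ (M.S *ᵥ v)
  diag_S : ∀ i, M.S i i = 1
  row_le : ∀ t, max (M.rowX t) (M.rowU t) ≤ K
  col_le : ∀ j, M.colS j ≤ K

/-- For each covariate `i`, the products `x_{ti} u_t`, `t = 1, …, T`, form a martingale difference
sequence with respect to some filtration `ℱ 0 ≤ ℱ 1 ≤ … ≤ ℱ T`. (The index `t : Fin T` starts at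
`0`, so the product with index `t` is the one at time `t + 1`.) -/
def IsMDS [m0 : MeasurableSpace Ω] (M : Model Ω T p) (P : Measure Ω) : Prop :=
  ∀ i : Fin p, ∃ ℱ : Filtration ℕ m0, ∀ t : Fin T,
    StronglyMeasurable[ℱ ((t : ℕ) + 1)] (fun ω => M.X ω t i * M.u ω t) ∧
    Integrable (fun ω => M.X ω t i * M.u ω t) P ∧
    P[fun ω => M.X ω t i * M.u ω t | ℱ (t : ℕ)] =ᵐ[P] 0

end Model

/-- The regularization parameter `λ = c₀ log(pT) (log p / T)^{1/2}`. -/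
def regParam (c0 : ℝ) (T p : ℕ) : ℝ :=
  c0 * Real.log ((p : ℝ) * T) * Real.sqrt (Real.log p / T)

end PenalizedTS

end

/-! The estimator is a global minimizer of `Q` over the `(m - s)`-sparse vectors. Since `2 s ≤ m`,
`β₀` is a competitor, and the error `d = β̂ - β₀` is `m`-sparse. The bounds hold whenever two events
occur: the noise satisfies `|∑ₜ x_{ti} u_t| ≤ λ T / 4` for every `i`, and `γ ‖v‖² T ≤ ‖X v‖²` for
every `m`-sparse `v`.

On these events the argument is deterministic (`oracle_bounds`). From `λ|v| ≤ q|v| + μ v² / 2` the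
noise term is absorbed by a quarter of the penalty of `d` plus a small multiple of `‖d‖²`, which the
curvature `γ > μ / 2` dominates. This leaves a cone condition on penalties, and `exists_cone` turns
it into a cone condition on `ℓ₁` norms.

Noise (`measure_noise_ge_le`): the martingale difference condition forces `(R_X)_{st} (R_u)_{st} =
0` for `s ≠ t`. Hence the Gaussian chaos `∑ₜ x_{ti} u_t` has variance of order `T` rather than
something larger, and its tail is exponential at scale `√T`. At the level `λ T / 4` the exponent is
a constant times `√(log p) log (pT)`, which eventually exceeds `2 log p` and survives the union over
`p` covariates.

Design (`measure_not_sparse_eigenvalue_le`): for fixed `w`, `‖Z w‖² / ‖w‖²` is chi-square with `T`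
degrees of freedom and falls below `T / 8` with probability at most `exp (-3T/5)`. A net of the
sparse unit vectors has log-cardinality about `m log p ≤ φ² T + o(T)`, and `φ² < 1/2` makes the
union bound work. The two events fail with probability at most `3 / p` and `2 / p`.

The penalty may be bounded, so the objective need not be coercive. Existence of a minimizer uses
concavity of the penalty (`exists_shift`, `exists_min_supported`), and measurability a selection
argument (`exists_measurable_argmin`). -/

namespace PenalizedTS

/-! ### Elementary inequalities for folded-concave penalties -/

namespace IsFoldedConcave

variable {q : ℝ → ℝ} {lam μ : ℝ}

theorem nonneg (h : IsFoldedConcave q lam μ) {v : ℝ} (hv : 0 ≤ v) : 0 ≤ q v := by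
  simpa [h.zero] using h.mono (Set.mem_Ici.2 le_rfl) (Set.mem_Ici.2 hv) hv

/-- The chord from `0` to `1` of the convex function `q v + μ v² / 2`. It rules out a jump of `q` at
`0`, which concavity and monotonicity alone would allow. -/
theorem le_mul_of_le_one (h : IsFoldedConcave q lam μ) {v : ℝ} (hv : 0 ≤ v) (hv1 : v ≤ 1) :
    q v ≤ v * (q 1 + μ / 2) := by
  have := h.convex_add.2 (Set.mem_Ici.2 (le_refl (0 : ℝ))) (Set.mem_Ici.2 (zero_le_one' ℝ))
    (sub_nonneg.2 hv1) hv (by ring)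
  simp only [smul_eq_mul, mul_zero, mul_one, zero_add, h.zero] at this
  have hμ := h.mu_pos
  have : 0 ≤ μ * v ^ 2 / 2 := by positivity
  linarith

theorem continuousOn (h : IsFoldedConcave q lam μ) : ContinuousOn q (Set.Ici 0) := by
  intro x hx
  rcases eq_or_lt_of_le (Set.mem_Ici.1 hx) with rfl | hx0
  · have h1 : Tendsto (fun v : ℝ => v * (q 1 + μ / 2)) (𝓝[≥] 0) (𝓝 0) := by
      have : Tendsto (fun v : ℝ => v * (q 1 + μ / 2)) (𝓝 0) (𝓝 (0 * (q 1 + μ / 2))) :=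
        (continuous_id.mul continuous_const).tendsto 0
      rw [zero_mul] at this
      exact this.mono_left nhdsWithin_le_nhds
    rw [ContinuousWithinAt, h.zero]
    refine tendsto_of_tendsto_of_tendsto_of_le_of_le' tendsto_const_nhds h1 ?_ ?_
    · filter_upwards [self_mem_nhdsWithin] with v hv using h.nonneg hv
    · filter_upwards [self_mem_nhdsWithin, nhdsWithin_le_nhds (Iio_mem_nhds zero_lt_one)]
        with v hv hv1 using h.le_mul_of_le_one hv (le_of_lt hv1)
  · exact ((h.differentiable x hx0).differentiableAt
      (Ioi_mem_nhds hx0)).continuousAt.continuousWithinAt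

/-- Given continuity at `0`, the limit of the derivative is the one-sided derivative there, so `λ`
is also the limit of the slopes from the origin. -/
theorem tendsto_ratio (h : IsFoldedConcave q lam μ) :
    Tendsto (fun v => q v / v) (𝓝[>] 0) (𝓝 lam) := by
  have h1 : HasDerivWithinAt q lam (Set.Ici 0) 0 :=
    hasDerivWithinAt_Ici_of_tendsto_deriv h.differentiable
      ((h.continuousOn 0 Set.self_mem_Ici).mono Set.Ioi_subset_Ici_self)
      self_mem_nhdsWithin h.deriv_zero
  have h2 := (hasDerivWithinAt_iff_tendsto_slope' (by simp)).1
    (h1.mono Set.Ioi_subset_Ici_self)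
  refine h2.congr fun v => ?_
  simp [slope_def_field, h.zero]

theorem le_mul (h : IsFoldedConcave q lam μ) {v : ℝ} (hv : 0 ≤ v) : q v ≤ lam * v := by
  rcases eq_or_lt_of_le hv with rfl | hv
  · simp [h.zero]
  rw [← div_le_iff₀ hv]
  refine ge_of_tendsto h.tendsto_ratio ?_
  filter_upwards [self_mem_nhdsWithin, nhdsWithin_le_nhds (Iio_mem_nhds hv)] with w hw hwv
  exact h.ratio_antitone hw hv (le_of_lt hwv)

/-- The slopes from the origin of the convex function `q v + μ v² / 2` increase, and they start at
`λ`. This is what lets a linear noise term be charged to the penalty. -/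
theorem mul_le (h : IsFoldedConcave q lam μ) {v : ℝ} (hv : 0 ≤ v) :
    lam * v ≤ q v + μ * v ^ 2 / 2 := by
  rcases eq_or_lt_of_le hv with rfl | hv
  · simp [h.zero]
  rw [← le_div_iff₀ hv]
  have h1 : Tendsto (fun w => q w / w + μ * w / 2) (𝓝[>] 0) (𝓝 lam) := by
    have : Tendsto (fun w : ℝ => μ * w / 2) (𝓝[>] 0) (𝓝 (μ * 0 / 2)) :=
      ((by fun_prop : Continuous fun w : ℝ => μ * w / 2).tendsto 0).mono_left nhdsWithin_le_nhds
    simpa using h.tendsto_ratio.add this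
  refine le_of_tendsto h1 ?_
  filter_upwards [self_mem_nhdsWithin, nhdsWithin_le_nhds (Iio_mem_nhds hv)] with w hw hwv
  have hw0 : 0 < w := hw
  have hwv' : w < v := hwv
  have := h.convex_add.2 (Set.mem_Ici.2 (le_refl (0 : ℝ))) (Set.mem_Ici.2 hv.le)
    (sub_nonneg.2 ((div_le_one hv).2 hwv'.le)) (div_nonneg hw0.le hv.le) (by ring)
  simp only [smul_eq_mul, mul_zero, zero_add, h.zero] at this
  rw [div_mul_cancel₀ _ hv.ne'] at this
  have e1 : q w / w + μ * w / 2 = (q w + μ * w ^ 2 / 2) / w := by field_simp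
  rw [e1, div_le_iff₀ hw0]
  calc _ ≤ _ := this
    _ = _ := by simp; field_simp

theorem ratio_le (h : IsFoldedConcave q lam μ) {a b : ℝ} (ha : 0 < a) (hab : a ≤ b) :
    q b ≤ b * (q a / a) := by
  have hb := ha.trans_le hab
  have := h.ratio_antitone ha hb hab
  simp only at this
  rwa [div_le_iff₀ hb, mul_comm] at this

/-- With `ratio_le`, this places `q` above the line through the origin and `(a, q a)` to the left of
`a`, and below it to the right. -/
theorem le_ratio (h : IsFoldedConcave q lam μ) {a b : ℝ} (hb : 0 ≤ b) (hab : b ≤ a) :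
    b * (q a / a) ≤ q b := by
  rcases eq_or_lt_of_le hb with rfl | hb
  · simp [h.zero]
  have := h.ratio_antitone hb (hb.trans_le hab) hab
  simp only at this
  rwa [le_div_iff₀ hb, mul_comm] at this

theorem add_le (h : IsFoldedConcave q lam μ) {a b : ℝ} (ha : 0 ≤ a) (hb : 0 ≤ b) :
    q (a + b) ≤ q a + q b := by
  rcases eq_or_lt_of_le ha with rfl | ha
  · simp [h.zero]
  have h1 := h.le_ratio (a := a + b) ha.le (by linarith)
  have h2 := h.le_ratio (a := a + b) hb (by linarith)
  have : q (a + b) = a * (q (a + b) / (a + b)) + b * (q (a + b) / (a + b)) := by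
    field_simp
  linarith

theorem abs_le_add (h : IsFoldedConcave q lam μ) (a b : ℝ) :
    q |a| ≤ q |b| + q |b - a| := by
  refine (h.mono (Set.mem_Ici.2 (abs_nonneg a)) (Set.mem_Ici.2 (by positivity)) ?_).trans
    (h.add_le (abs_nonneg b) (abs_nonneg (b - a)))
  have := abs_sub_abs_le_abs_sub a b
  rw [abs_sub_comm] at this
  linarith

theorem pos (h : IsFoldedConcave q lam μ) (hlam : 0 < lam) {v : ℝ} (hv : 0 < v) : 0 < q v := by
  have h1 := h.tendsto_ratio.eventually (lt_mem_nhds hlam)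
  obtain ⟨w, hw, hw0, hwv⟩ := (h1.and ((eventually_mem_nhdsWithin (a := (0 : ℝ)) (s := Set.Ioi 0)).and
    (nhdsWithin_le_nhds (Iio_mem_nhds hv)))).exists
  have hw0 : 0 < w := hw0
  have : 0 < q w := by
    have := mul_pos hw hw0
    rwa [div_mul_cancel₀ _ hw0.ne'] at this
  exact this.trans_le (h.mono hw0.le hv.le (le_of_lt hwv))

end IsFoldedConcave

/-! ### From a cone condition on penalties to one on absolute values -/

theorem exists_top_finset {ι : Type*} [Fintype ι] [DecidableEq ι] (f : ι → ℝ) (k : ℕ)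
    (hk : k ≤ Fintype.card ι) :
    ∃ A : Finset ι, A.card = k ∧ ∀ i ∈ A, ∀ j ∉ A, f j ≤ f i := by
  induction k with
  | zero => exact ⟨∅, by simp⟩
  | succ k ih =>
    obtain ⟨A, hA, hA'⟩ := ih (by omega)
    have hne : (Aᶜ).Nonempty := by
      rw [← Finset.card_pos, Finset.card_compl]; omega
    obtain ⟨x, hx, hx'⟩ := Finset.exists_max_image Aᶜ f hne
    have hxA : x ∉ A := by simpa using hx
    refine ⟨insert x A, by simp [hxA, hA], ?_⟩
    intro i hi j hj
    rw [Finset.mem_insert, not_or] at hj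
    rcases Finset.mem_insert.1 hi with rfl | hi
    · exact hx' j (by simpa using hj.2)
    · exact hA' i hi j hj.2

/-- Exchange argument: `J \ A` has no more elements than `A \ J`, and each of its values is at most
each value on `A \ J`. -/
theorem sum_le_sum_of_top {ι : Type*} [DecidableEq ι] {h : ι → ℝ} (hh : ∀ i, 0 ≤ h i)
    {A J : Finset ι} (hA : ∀ i ∈ A, ∀ j ∉ A, h j ≤ h i) (hc : J.card ≤ A.card) :
    ∑ j ∈ J, h j ≤ ∑ j ∈ A, h j := by
  have hcard : (J \ A).card ≤ (A \ J).card := by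
    have h1 := Finset.card_sdiff_add_card_inter J A
    have h2 := Finset.card_sdiff_add_card_inter A J
    rw [Finset.inter_comm] at h2
    omega
  have key : ∑ j ∈ J \ A, h j ≤ ∑ j ∈ A \ J, h j := by
    rcases (A \ J).eq_empty_or_nonempty with h0 | hne
    · rw [h0, Finset.card_empty, Nat.le_zero, Finset.card_eq_zero] at hcard
      simp [h0, hcard]
    · obtain ⟨i, hi, hmin⟩ := Finset.exists_min_image (A \ J) h hne
      have hi' := Finset.mem_sdiff.1 hi
      calc ∑ j ∈ J \ A, h j ≤ (J \ A).card • h i :=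
            Finset.sum_le_card_nsmul _ _ _ fun j hj => hA i hi'.1 j (Finset.mem_sdiff.1 hj).2
        _ ≤ (A \ J).card • h i := nsmul_le_nsmul_left (hh i) hcard
        _ ≤ _ := Finset.card_nsmul_le_sum _ _ _ hmin
  rw [← Finset.sum_inter_add_sum_sdiff J A, ← Finset.sum_inter_add_sum_sdiff A J,
    Finset.inter_comm]
  linarith

/-- If the penalty of a vector off a set of at most `k` coordinates is at most `c` times the
penalty on it, then its `ℓ₁` norm is within a factor `1 + c` of that of its `k` largest
entries. -/
theorem IsFoldedConcave.exists_cone {q : ℝ → ℝ} {lam μ : ℝ} (h : IsFoldedConcave q lam μ)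
    (hlam : 0 < lam) {ι : Type*} [Fintype ι] [DecidableEq ι] (d : ι → ℝ) (J : Finset ι)
    {c : ℝ} (hc : 0 ≤ c)
    (hJ : ∑ j ∈ Jᶜ, q |d j| ≤ c * ∑ j ∈ J, q |d j|) :
    ∃ A : Finset ι, A.card = J.card ∧ ∑ j ∈ J, q |d j| ≤ ∑ j ∈ A, q |d j| ∧
      ∑ j ∈ Aᶜ, |d j| ≤ c * ∑ j ∈ A, |d j| := by
  obtain ⟨A, hA, htop⟩ := exists_top_finset (fun j => |d j|) J.card (Finset.card_le_univ J)
  have hle : ∑ j ∈ J, q |d j| ≤ ∑ j ∈ A, q |d j| :=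
    sum_le_sum_of_top (fun i => h.nonneg (abs_nonneg _))
      (fun i hi j hj => h.mono (Set.mem_Ici.2 (abs_nonneg _)) (Set.mem_Ici.2 (abs_nonneg _))
        (htop i hi j hj)) hA.ge
  refine ⟨A, hA, hle, ?_⟩
  have hA' : ∑ j ∈ Aᶜ, q |d j| ≤ c * ∑ j ∈ A, q |d j| := by
    have e1 := Finset.sum_add_sum_compl A fun j => q |d j|
    have e2 := Finset.sum_add_sum_compl J fun j => q |d j|
    have := mul_le_mul_of_nonneg_left hle hc
    linarith
  rcases A.eq_empty_or_nonempty with rfl | hne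
  · simp only [Finset.sum_empty, mul_zero] at hA' ⊢
    refine (Finset.sum_nonpos fun j hj => ?_)
    by_contra! hpos
    have h1 := Finset.single_le_sum (f := fun j => q |d j|)
      (fun j _ => h.nonneg (abs_nonneg (d j))) hj
    have := h.pos hlam hpos
    linarith
  -- The smallest entry on `A` is the threshold between `A` and its complement. The line through the
  -- origin and the graph of `q` at this threshold bounds `q` from above on `A` and from below off
  -- `A`, so its slope cancels from the penalty inequality.
  obtain ⟨i, hi, hmin⟩ := Finset.exists_min_image A (fun j => |d j|) hne
  rcases eq_or_lt_of_le (abs_nonneg (d i)) with h0 | hpos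
  · have : ∑ j ∈ Aᶜ, |d j| ≤ 0 := Finset.sum_nonpos fun j hj => by
      rw [h0]; exact htop i hi j (by simpa using hj)
    exact this.trans (mul_nonneg hc (Finset.sum_nonneg fun j _ => abs_nonneg _))
  have hk : 0 < q |d i| / |d i| := div_pos (h.pos hlam hpos) hpos
  have h1 : (∑ j ∈ Aᶜ, |d j|) * (q |d i| / |d i|) ≤ ∑ j ∈ Aᶜ, q |d j| := by
    rw [Finset.sum_mul]
    exact Finset.sum_le_sum fun j hj => h.le_ratio (abs_nonneg _)
      (htop i hi j (by simpa using hj))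
  have h2 : ∑ j ∈ A, q |d j| ≤ (∑ j ∈ A, |d j|) * (q |d i| / |d i|) := by
    rw [Finset.sum_mul]
    exact Finset.sum_le_sum fun j hj => h.ratio_le hpos (hmin j hj)
  refine le_of_mul_le_mul_right ?_ hk
  calc _ ≤ _ := h1
    _ ≤ _ := hA'
    _ ≤ c * ((∑ j ∈ A, |d j|) * (q |d i| / |d i|)) := mul_le_mul_of_nonneg_left h2 hc
    _ = _ := by ring

/-! ### The deterministic oracle inequality -/

theorem l2_sq {ι : Type*} [Fintype ι] (v : ι → ℝ) : l2 v ^ 2 = ∑ j, v j ^ 2 :=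
  Real.sq_sqrt (Finset.sum_nonneg fun _ _ => sq_nonneg _)

theorem l2_nonneg {ι : Type*} [Fintype ι] (v : ι → ℝ) : 0 ≤ l2 v := Real.sqrt_nonneg _

theorem sum_abs_le_sqrt_card_mul_l2 {ι : Type*} [Fintype ι] (v : ι → ℝ) (A : Finset ι) :
    ∑ j ∈ A, |v j| ≤ Real.sqrt A.card * l2 v := by
  rw [l2, ← Real.sqrt_mul (Nat.cast_nonneg _)]
  refine Real.le_sqrt_of_sq_le ?_
  calc (∑ j ∈ A, |v j|) ^ 2 ≤ A.card * ∑ j ∈ A, |v j| ^ 2 := sq_sum_le_card_mul_sum_sq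
    _ ≤ _ := by
      refine mul_le_mul_of_nonneg_left ?_ (Nat.cast_nonneg _)
      simp only [sq_abs]
      exact Finset.sum_le_univ_sum_of_nonneg fun _ => sq_nonneg _

/-- Cancelling `n` leaves `(γ - μ/4) n ≤ 5L/2`. Multiplied by `12/5`, its left side exceeds `(2γ -
μ) n` by `2(γ + μ) n / 5 ≥ 0`. -/
theorem linear_bound {D n L γ μ : ℝ} (hn : 0 ≤ n) (hL : 0 ≤ L) (hμ : 0 < μ) (hγ : μ / 2 < γ)
    (hDn : γ * n ^ 2 ≤ D) (hD : D ≤ 5 / 2 * (L * n) + μ / 4 * n ^ 2) :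
    n * (2 * γ - μ) ≤ 6 * L := by
  rcases eq_or_lt_of_le hn with h0 | hpos
  · rw [← h0, zero_mul]; positivity
  have h1 : (γ - μ / 4) * n ≤ 5 / 2 * L := by
    refine le_of_mul_le_mul_right ?_ hpos
    calc (γ - μ / 4) * n * n = γ * n ^ 2 - μ / 4 * n ^ 2 := by ring
      _ ≤ 5 / 2 * (L * n) := by linarith
      _ = _ := by ring
  have h2 : 0 ≤ (γ + μ) * n := mul_nonneg (by linarith) hn
  linarith

/-- The term `μ n² / 4` is at most `D / 2`, so `D ≤ 5 L n`. Squaring and using `γ n² ≤ D` removes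
`n`. -/
theorem quadratic_bound {D n L γ μ : ℝ} (hμ : 0 < μ) (hγ : μ / 2 < γ)
    (hDn : γ * n ^ 2 ≤ D) (hD : D ≤ 5 / 2 * (L * n) + μ / 4 * n ^ 2) :
    D * γ ≤ 25 * L ^ 2 := by
  have hγ0 : 0 < γ := by linarith
  have h0 : μ / 2 * n ^ 2 ≤ γ * n ^ 2 := mul_le_mul_of_nonneg_right hγ.le (sq_nonneg n)
  have h1 : D ≤ 5 * (L * n) := by linarith
  have hD0 : 0 ≤ D := (by positivity : 0 ≤ γ * n ^ 2).trans hDn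
  rcases eq_or_lt_of_le hD0 with h | hpos
  · rw [← h, zero_mul]; positivity
  refine le_of_mul_le_mul_right ?_ hpos
  calc D * γ * D = γ * D ^ 2 := by ring
    _ ≤ γ * (5 * (L * n)) ^ 2 := by gcongr
    _ = 25 * L ^ 2 * (γ * n ^ 2) := by ring
    _ ≤ 25 * L ^ 2 * D := by gcongr

/-- The deterministic error bounds for a vector `b` whose penalized objective does not exceed that
of `b₀`, when the noise is dominated by `λ / 4` and the design is well conditioned in the direction
of the error. -/
theorem oracle_bounds {T p s : ℕ} (hT : 0 < T) {q : ℝ → ℝ} {lam μ γ : ℝ}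
    (hq : IsFoldedConcave q lam μ) (hlam : 0 < lam) (hγ : μ / 2 < γ)
    (X : Matrix (Fin T) (Fin p) ℝ) (u : Fin T → ℝ) (b0 b : Fin p → ℝ) (hs : l0 b0 = s)
    (hmin : (2 * (T : ℝ))⁻¹ * l2 (X *ᵥ b0 + u - X *ᵥ b) ^ 2 + ∑ j, |q (|b j|)|
      ≤ (2 * (T : ℝ))⁻¹ * l2 (X *ᵥ b0 + u - X *ᵥ b0) ^ 2 + ∑ j, |q (|b0 j|)|)
    (hnoise : ∀ i, |∑ t, X t i * u t| ≤ lam / 4 * T)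
    (hre : γ * l2 (b - b0) ^ 2 * T ≤ l2 (X *ᵥ (b - b0)) ^ 2) :
    l2 (b - b0) ≤ 6 * Real.sqrt s * lam / (2 * γ - μ) ∧
    l1 (b - b0) ≤ 24 * (s : ℝ) * lam / (2 * γ - μ) ∧
    (Real.sqrt T)⁻¹ * l2 (X *ᵥ (b - b0)) ≤ 9 * Real.sqrt s * lam / Real.sqrt (2 * γ - μ) := by
  classical
  have hT' : (0 : ℝ) < T := by exact_mod_cast hT
  have hμ := hq.mu_pos
  set d := b - b0 with hd
  set J := Finset.univ.filter fun j => b0 j ≠ 0 with hJ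
  set D := (T : ℝ)⁻¹ * l2 (X *ᵥ d) ^ 2 with hD
  set n := l2 d with hn
  have hn0 : 0 ≤ n := l2_nonneg d
  have hDn : γ * n ^ 2 ≤ D := by
    rw [hD, le_inv_mul_iff₀ hT']; linarith
  -- the basic inequality
  have hres : X *ᵥ b0 + u - X *ᵥ b = u - X *ᵥ d := by
    rw [hd, mulVec_sub]; abel
  have hres0 : X *ᵥ b0 + u - X *ᵥ b0 = u := by abel
  have hexp : l2 (u - X *ᵥ d) ^ 2 = l2 u ^ 2 - 2 * (∑ t, u t * (X *ᵥ d) t) + l2 (X *ᵥ d) ^ 2 := by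
    simp only [l2_sq, Pi.sub_apply]
    rw [Finset.mul_sum, ← Finset.sum_sub_distrib, ← Finset.sum_add_distrib]
    exact Finset.sum_congr rfl fun t _ => by ring
  have hcross : ∑ t, u t * (X *ᵥ d) t = ∑ i, d i * ∑ t, X t i * u t := by
    simp only [mulVec, dotProduct, Finset.mul_sum]
    rw [Finset.sum_comm]
    exact Finset.sum_congr rfl fun t _ => Finset.sum_congr rfl fun i _ => by ring
  -- Coordinatewise, the noise bound gives `λ |d i| / 4`, which `mul_le` replaces by a quarter of
  -- the penalty plus a quadratic correction.
  have hcross_le : ∑ t, u t * (X *ᵥ d) t ≤ T * (4⁻¹ * (∑ j, q |d j|) + μ / 8 * n ^ 2) := by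
    have h1 : ∑ t, u t * (X *ᵥ d) t ≤ ∑ i, T * (4⁻¹ * (q |d i| + μ * d i ^ 2 / 2)) := by
      rw [hcross]
      refine Finset.sum_le_sum fun i _ => ?_
      have h2 := hq.mul_le (abs_nonneg (d i))
      rw [sq_abs] at h2
      calc d i * ∑ t, X t i * u t ≤ |d i| * |∑ t, X t i * u t| := by
            rw [← abs_mul]; exact le_abs_self _
        _ ≤ |d i| * (lam / 4 * T) := mul_le_mul_of_nonneg_left (hnoise i) (abs_nonneg _)
        _ = T * (4⁻¹ * (lam * |d i|)) := by ring
        _ ≤ _ := by gcongr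
    refine h1.trans_eq ?_
    rw [hn, l2_sq, ← Finset.mul_sum, ← Finset.mul_sum, Finset.sum_add_distrib, ← Finset.sum_div,
      ← Finset.mul_sum]
    ring
  have habs : ∀ v : Fin p → ℝ, ∑ j, |q (|v j|)| = ∑ j, q |v j| := fun v =>
    Finset.sum_congr rfl fun j _ => abs_of_nonneg (hq.nonneg (abs_nonneg _))
  have hpen : ∑ j, q |b0 j| - ∑ j, q |b j| ≤ ∑ j ∈ J, q |d j| - ∑ j ∈ Jᶜ, q |d j| := by
    rw [← Finset.sum_add_sum_compl J fun j => q |b0 j|,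
      ← Finset.sum_add_sum_compl J fun j => q |b j|]
    have h1 : ∑ j ∈ J, q |b0 j| ≤ ∑ j ∈ J, q |b j| + ∑ j ∈ J, q |d j| := by
      rw [← Finset.sum_add_distrib]
      exact Finset.sum_le_sum fun j _ => hq.abs_le_add (b0 j) (b j)
    have h2 : ∑ j ∈ Jᶜ, q |b0 j| = 0 := Finset.sum_eq_zero fun j hj => by
      have : b0 j = 0 := by simpa [hJ] using hj
      simp [this, hq.zero]
    have h3 : ∑ j ∈ Jᶜ, q |b j| = ∑ j ∈ Jᶜ, q |d j| := Finset.sum_congr rfl fun j hj => by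
      have : b0 j = 0 := by simpa [hJ] using hj
      simp [hd, this]
    linarith
  have hbasic : D / 2 ≤ 4⁻¹ * (∑ j, q |d j|) + μ / 8 * n ^ 2 +
      (∑ j ∈ J, q |d j| - ∑ j ∈ Jᶜ, q |d j|) := by
    rw [hres, hres0, hexp, habs, habs] at hmin
    have h1 : (T : ℝ)⁻¹ * ∑ t, u t * (X *ᵥ d) t ≤ 4⁻¹ * (∑ j, q |d j|) + μ / 8 * n ^ 2 := by
      rw [inv_mul_le_iff₀ hT']; exact hcross_le
    have h2 : (2 * (T : ℝ))⁻¹ * (l2 u ^ 2 - 2 * (∑ t, u t * (X *ᵥ d) t) + l2 (X *ᵥ d) ^ 2)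
        = (2 * (T : ℝ))⁻¹ * l2 u ^ 2 - (T : ℝ)⁻¹ * (∑ t, u t * (X *ᵥ d) t) + D / 2 := by
      rw [hD, mul_inv]; ring
    linarith
  have hsum := Finset.sum_add_sum_compl J fun j => q |d j|
  have hn2 : 0 ≤ n ^ 2 := sq_nonneg n
  have hDμ : μ / 2 * n ^ 2 ≤ D := (mul_le_mul_of_nonneg_right hγ.le hn2).trans hDn
  -- Since `D / 2` dominates `μ n² / 8`, `hbasic` leaves `3/4` of the penalty off `J` against `5/4`
  -- of the penalty on `J`. The ratio `5/3` is relaxed to `3`, which makes the `ℓ₁` factor `1 + 3 =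
  -- 4`.
  have hcone : ∑ j ∈ Jᶜ, q |d j| ≤ 3 * ∑ j ∈ J, q |d j| := by
    have : 0 ≤ ∑ j ∈ J, q |d j| := Finset.sum_nonneg fun j _ => hq.nonneg (abs_nonneg _)
    have hμn : 0 ≤ μ * n ^ 2 := by positivity
    linarith
  obtain ⟨A, hAc, hA, hAcone⟩ := hq.exists_cone hlam d J (by norm_num) hcone
  have hJs : J.card = s := hs
  have hA1 := sum_abs_le_sqrt_card_mul_l2 d A
  rw [hAc, hJs] at hA1
  have hpJ : ∑ j ∈ J, q |d j| ≤ lam * (Real.sqrt s * n) := by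
    have h1 := sum_abs_le_sqrt_card_mul_l2 d J
    rw [hJs] at h1
    calc ∑ j ∈ J, q |d j| ≤ ∑ j ∈ J, lam * |d j| :=
          Finset.sum_le_sum fun j _ => hq.le_mul (abs_nonneg _)
      _ = lam * ∑ j ∈ J, |d j| := by rw [Finset.mul_sum]
      _ ≤ _ := mul_le_mul_of_nonneg_left h1 hlam.le
  set r := Real.sqrt s with hr
  have hr0 : 0 ≤ r := Real.sqrt_nonneg _
  have hDle : D ≤ 5 / 2 * (lam * r * n) + μ / 4 * n ^ 2 := by
    have : 0 ≤ ∑ j ∈ Jᶜ, q |d j| := Finset.sum_nonneg fun j _ => hq.nonneg (abs_nonneg _)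
    linarith
  have hκ : 0 < 2 * γ - μ := by linarith
  have hγ0 : 0 < γ := by linarith
  have ha : n ≤ 6 * r * lam / (2 * γ - μ) := by
    rw [le_div_iff₀ hκ]
    have := linear_bound hn0 (by positivity : 0 ≤ lam * r) hμ hγ hDn hDle
    linarith
  refine ⟨ha, ?_, ?_⟩
  · have h1 : l1 d ≤ 4 * (r * n) := by
      rw [l1, ← Finset.sum_add_sum_compl A fun j => |d j|]
      linarith
    have h2 : r * r = s := Real.mul_self_sqrt (Nat.cast_nonneg _)
    calc l1 d ≤ 4 * (r * n) := h1
      _ ≤ 4 * (r * (6 * r * lam / (2 * γ - μ))) := by gcongr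
      _ = 24 * (r * r) * lam / (2 * γ - μ) := by ring
      _ = _ := by rw [h2]
  · set e := (Real.sqrt T)⁻¹ * l2 (X *ᵥ d) with he
    have he0 : 0 ≤ e := mul_nonneg (inv_nonneg.2 (Real.sqrt_nonneg _)) (l2_nonneg _)
    have heD : e ^ 2 = D := by
      rw [he, hD, mul_pow, inv_pow, Real.sq_sqrt hT'.le]
    have hκs := Real.sqrt_pos.2 hκ
    rw [le_div_iff₀ hκs]
    refine abs_le_of_sq_le_sq' ?_ (by positivity) |>.2
    rw [mul_pow, heD, Real.sq_sqrt hκ.le]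
    have hL : 0 ≤ lam * r := by positivity
    have h2 : D * γ ≤ 25 * (lam * r) ^ 2 :=
      quadratic_bound hμ hγ hDn hDle
    have h3 : 0 ≤ D * μ := mul_nonneg (heD ▸ sq_nonneg e) hμ.le
    have h4 : 0 ≤ (lam * r) ^ 2 := sq_nonneg _
    have h5 : (9 * r * lam) ^ 2 = 81 * (lam * r) ^ 2 := by ring
    rw [h5]
    linarith

end PenalizedTS

/-! ### Existence of sparse minimizers -/

namespace PenalizedTS

/-- A vector can be moved along a given nonzero direction, without increasing its penalty, until
one of the moving coordinates vanishes. -/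
theorem IsFoldedConcave.exists_shift {q : ℝ → ℝ} {lam μ : ℝ} (h : IsFoldedConcave q lam μ)
    {ι : Type*} [Fintype ι] (b n : ι → ℝ) (hn : ∃ j, n j ≠ 0) :
    ∃ t : ℝ, ∃ j, n j ≠ 0 ∧ b j + t * n j = 0 ∧ ∑ i, q |b i + t * n i| ≤ ∑ i, q |b i| := by
  classical
  -- `z j` is the time at which coordinate `j` vanishes along the line.
  set z : ι → ℝ := fun j => -b j / n j with hz
  set S := Finset.univ.filter fun j => n j ≠ 0 with hS
  have hzero : ∀ j ∈ S, b j + z j * n j = 0 := fun j hj => by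
    have : n j ≠ 0 := by simpa [hS] using hj
    simp only [hz]; field_simp; ring
  have hform : ∀ t, ∀ j, n j ≠ 0 → |b j + t * n j| = |n j| * |t - z j| := fun t j hj => by
    rw [← abs_mul]; congr 1
    simp only [hz]; field_simp; ring
  have hmem : ∀ {j}, j ∈ S → n j ≠ 0 := fun {j} hj => by simpa [hS] using hj
  by_cases h0 : ∃ j ∈ S, z j = 0
  · obtain ⟨j, hj, hj0⟩ := h0
    have := hzero j hj
    rw [hj0] at this
    exact ⟨0, j, hmem hj, this, by simp⟩
  push Not at h0
  -- the case of breakpoints on one side only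
  have oneside : ∀ k ∈ S, (∀ j ∈ S, |z k - z j| ≤ |z j|) →
      ∑ i, q |b i + z k * n i| ≤ ∑ i, q |b i| := by
    intro k hk hk'
    refine Finset.sum_le_sum fun i _ => ?_
    by_cases hi : n i = 0
    · simp [hi]
    refine h.mono (Set.mem_Ici.2 (abs_nonneg _)) (Set.mem_Ici.2 (abs_nonneg _)) ?_
    have e := hform 0 i hi
    rw [zero_mul, add_zero, zero_sub, abs_neg] at e
    rw [hform _ i hi, e]
    exact mul_le_mul_of_nonneg_left (hk' i (by simpa [hS] using hi)) (abs_nonneg _)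
  set Pz := S.filter fun j => 0 < z j with hPz
  set Nz := S.filter fun j => z j < 0 with hNz
  have hsplit : ∀ j ∈ S, j ∈ Pz ∨ j ∈ Nz := fun j hj => by
    rcases lt_or_gt_of_ne (h0 j hj) with h1 | h1
    · right; simp [hNz, hj, h1]
    · left; simp [hPz, hj, h1]
  rcases Pz.eq_empty_or_nonempty with hP | hP
  · have hN : Nz.Nonempty := by
      obtain ⟨j, hj⟩ := hn
      have hjS : j ∈ S := by simpa [hS] using hj
      rcases hsplit j hjS with h1 | h1
      · rw [hP] at h1; simp at h1
      · exact ⟨j, h1⟩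
    obtain ⟨k, hk, hmax⟩ := Finset.exists_max_image Nz z hN
    have hkS := (Finset.mem_filter.1 hk).1
    refine ⟨z k, k, hmem hkS, hzero k hkS, oneside k hkS fun j hj => ?_⟩
    rcases hsplit j hj with h1 | h1
    · rw [hP] at h1; simp at h1
    · have := hmax j h1
      have h2 := (Finset.mem_filter.1 hk).2
      have h3 := (Finset.mem_filter.1 h1).2
      rw [abs_of_nonneg (by linarith), abs_of_neg h3]; linarith
  rcases Nz.eq_empty_or_nonempty with hN | hN
  · obtain ⟨k, hk, hmin⟩ := Finset.exists_min_image Pz z hP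
    have hkS := (Finset.mem_filter.1 hk).1
    refine ⟨z k, k, hmem hkS, hzero k hkS, oneside k hkS fun j hj => ?_⟩
    rcases hsplit j hj with h1 | h1
    · have := hmin j h1
      have h2 := (Finset.mem_filter.1 hk).2
      have h3 := (Finset.mem_filter.1 h1).2
      rw [abs_of_nonpos (by linarith), abs_of_pos h3]; linarith
    · rw [hN] at h1; simp at h1
  obtain ⟨k, hk, hmin⟩ := Finset.exists_min_image Pz z hP
  obtain ⟨l, hl, hmax⟩ := Finset.exists_max_image Nz z hN
  have hkS := (Finset.mem_filter.1 hk).1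
  have hlS := (Finset.mem_filter.1 hl).1
  have hk0 : 0 < z k := (Finset.mem_filter.1 hk).2
  have hl0 : z l < 0 := (Finset.mem_filter.1 hl).2
  set α := z k / (z k - z l) with hα
  set β := -z l / (z k - z l) with hβ
  have hden : 0 < z k - z l := by linarith
  have hα0 : 0 ≤ α := by positivity
  have hβ0 : 0 ≤ β := div_nonneg (by linarith) hden.le
  have hαβ : α + β = 1 := by rw [hα, hβ]; field_simp; ring
  have hcomb : α * z l + β * z k = 0 := by rw [hα, hβ]; field_simp; ring
  have hconc : α * ∑ i, q |b i + z l * n i| + β * ∑ i, q |b i + z k * n i| ≤ ∑ i, q |b i| := by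
    rw [Finset.mul_sum, Finset.mul_sum, ← Finset.sum_add_distrib]
    refine Finset.sum_le_sum fun i _ => ?_
    by_cases hi : n i = 0
    · simp only [hi, mul_zero, add_zero, ← add_mul, hαβ, one_mul, le_refl]
    have hiS : i ∈ S := by simpa [hS] using hi
    have key := h.concave.2 (Set.mem_Ici.2 (abs_nonneg (b i + z l * n i)))
      (Set.mem_Ici.2 (abs_nonneg (b i + z k * n i))) hα0 hβ0 hαβ
    simp only [smul_eq_mul] at key
    refine key.trans_eq ?_
    congr 1
    have e := hform 0 i hi
    rw [zero_mul, add_zero] at e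
    rw [hform _ i hi, hform _ i hi, e]
    have : α * |z l - z i| + β * |z k - z i| = |0 - z i| := by
      rcases hsplit i hiS with h1 | h1
      · have h2 := hmin i h1
        rw [abs_of_nonpos (by linarith), abs_of_nonpos (by linarith),
          abs_of_nonpos (by linarith)]
        linear_combination z i * hαβ - hcomb
      · have h2 := hmax i h1
        rw [abs_of_nonneg (by linarith), abs_of_nonneg (by linarith),
          abs_of_nonneg (by linarith)]
        linear_combination -z i * hαβ + hcomb
    rw [← this]; ring
  by_cases hle : ∑ i, q |b i + z k * n i| ≤ ∑ i, q |b i|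
  · exact ⟨z k, k, hmem hkS, hzero k hkS, hle⟩
  · refine ⟨z l, l, hmem hlS, hzero l hlS, ?_⟩
    push Not at hle
    by_contra! hcon
    rcases eq_or_lt_of_le hα0 with h1 | h1
    · have : β = 1 := by linarith
      rw [← h1, this] at hconc
      linarith
    · have h2 := mul_lt_mul_of_pos_left hcon h1
      have h3 := mul_le_mul_of_nonneg_left hle.le hβ0
      have h4 : α * ∑ i, q |b i| + β * ∑ i, q |b i| = ∑ i, q |b i| := by
        rw [← add_mul, hαβ, one_mul]
      linarith

/-- The penalized least-squares objective for fixed data. -/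
noncomputable def objective {T p : ℕ} (q : ℝ → ℝ) (X : Matrix (Fin T) (Fin p) ℝ) (y : Fin T → ℝ)
    (b : Fin p → ℝ) : ℝ :=
  (2 * (T : ℝ))⁻¹ * l2 (y - X *ᵥ b) ^ 2 + ∑ j, |q (|b j|)|

section Minimizer

variable {T p : ℕ} {q : ℝ → ℝ} {lam μ : ℝ}

theorem objective_eq (h : IsFoldedConcave q lam μ) (X : Matrix (Fin T) (Fin p) ℝ) (y : Fin T → ℝ)
    (b : Fin p → ℝ) :
    objective q X y b = (2 * (T : ℝ))⁻¹ * (∑ t, (y t - (X *ᵥ b) t) ^ 2) + ∑ j, q |b j| := by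
  simp only [objective, l2_sq, Pi.sub_apply]
  congr 1
  exact Finset.sum_congr rfl fun j _ => abs_of_nonneg (h.nonneg (abs_nonneg _))

theorem continuous_objective (h : IsFoldedConcave q lam μ) (X : Matrix (Fin T) (Fin p) ℝ)
    (y : Fin T → ℝ) : Continuous (objective q X y) := by
  have hq : Continuous fun v : ℝ => q |v| :=
    h.continuousOn.comp_continuous continuous_abs fun v => Set.mem_Ici.2 (abs_nonneg v)
  have : objective q X y = fun b => (2 * (T : ℝ))⁻¹ * (∑ t, (y t - (X *ᵥ b) t) ^ 2)
      + ∑ j, q |b j| := funext (objective_eq h X y)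
  rw [this]
  have h2 : Continuous fun b : Fin p → ℝ => ∑ j, q |b j| :=
    continuous_finsetSum _ fun j _ => hq.comp (continuous_apply j)
  have h1 : Continuous fun b : Fin p → ℝ => X *ᵥ b :=
    Continuous.matrix_mulVec continuous_const continuous_id
  fun_prop

/-- The objective attains its minimum over the vectors supported on `J`. -/
theorem exists_min_supported (h : IsFoldedConcave q lam μ) (hT : 0 < T)
    (X : Matrix (Fin T) (Fin p) ℝ) (y : Fin T → ℝ) (J : Finset (Fin p)) :
    ∃ b : Fin p → ℝ, (∀ j ∉ J, b j = 0) ∧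
      ∀ b', (∀ j ∉ J, b' j = 0) → objective q X y b ≤ objective q X y b' := by
  induction J using Finset.strongInduction with
  | H J ih =>
  -- A kernel direction leaves the fit unchanged, so `exists_shift` reduces to supports with one
  -- index fewer. Without one, `X` is injective on the coordinate subspace, the quadratic part is
  -- coercive there, and compactness applies.
  by_cases hker : ∃ n : Fin p → ℝ, n ≠ 0 ∧ (∀ j ∉ J, n j = 0) ∧ X *ᵥ n = 0
  · obtain ⟨n, hn0, hnJ, hXn⟩ := hker
    have hn : ∃ j, n j ≠ 0 := Function.ne_iff.1 hn0
    have hJn : ∀ j, n j ≠ 0 → j ∈ J := fun j hj => by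
      by_contra hc; exact hj (hnJ j hc)
    have ih' : ∀ j, ∃ b : Fin p → ℝ, j ∈ J → (∀ i ∉ J.erase j, b i = 0) ∧
        ∀ b', (∀ i ∉ J.erase j, b' i = 0) → objective q X y b ≤ objective q X y b' := fun j => by
      by_cases hj : j ∈ J
      · obtain ⟨b, hb⟩ := ih _ (Finset.erase_ssubset hj)
        exact ⟨b, fun _ => hb⟩
      · exact ⟨0, fun hc => absurd hc hj⟩
    choose B hB using ih'
    have hJne : J.Nonempty := hn.imp fun j hj => hJn j hj
    obtain ⟨k, hk, hkmin⟩ := Finset.exists_min_image J (fun j => objective q X y (B j)) hJne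
    refine ⟨B k, fun i hi => (hB k hk).1 i fun hc => hi (Finset.mem_of_mem_erase hc), ?_⟩
    intro b' hb'
    obtain ⟨t, j, hj, hj0, hle⟩ := h.exists_shift b' n hn
    have h1 := (hB j (hJn j hj)).2 (b' + t • n) (by
      intro i hi
      by_cases hij : i = j
      · simpa [hij] using hj0
      · have : i ∉ J := fun hc => hi (Finset.mem_erase.2 ⟨hij, hc⟩)
        simp [hb' i this, hnJ i this])
    refine (hkmin j (hJn j hj)).trans (h1.trans ?_)
    rw [objective_eq h, objective_eq h, mulVec_add, mulVec_smul, hXn, smul_zero, add_zero]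
    simpa using hle
  · push Not at hker
    let V : Submodule ℝ (Fin p → ℝ) :=
      { carrier := {b | ∀ j ∉ J, b j = 0}
        add_mem' := fun {a b} ha hb j hj => by simp [ha j hj, hb j hj]
        zero_mem' := fun j _ => rfl
        smul_mem' := fun c a ha j hj => by simp [ha j hj] }
    have hVc : IsClosed (V : Set (Fin p → ℝ)) := V.closed_of_finiteDimensional
    let L : V →ₗ[ℝ] (Fin T → ℝ) := X.mulVecLin ∘ₗ V.subtype
    have hL : LinearMap.ker L = ⊥ := by
      rw [LinearMap.ker_eq_bot']
      intro v hv
      by_contra hne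
      exact hker v (fun hc => hne (Subtype.ext hc)) v.2 hv
    obtain ⟨K, -, hK⟩ := L.exists_antilipschitzWith hL
    set C := objective q X y 0 with hC
    have hT' : (0 : ℝ) < T := by exact_mod_cast hT
    set R := (K : ℝ) * (Real.sqrt (2 * T * C) + ‖y‖) with hR
    have hbound : ∀ b ∈ V, objective q X y b ≤ C → ‖b‖ ≤ R := by
      intro b hb hbC
      have h1 : ‖b‖ ≤ K * ‖X *ᵥ b‖ := by
        have := hK.le_mul_dist ⟨b, hb⟩ 0
        simpa [dist_zero_right, L] using this
      refine h1.trans (mul_le_mul_of_nonneg_left ?_ K.2)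
      have h2 : ‖y - X *ᵥ b‖ ≤ Real.sqrt (2 * T * C) := by
        refine (pi_norm_le_iff_of_nonneg (Real.sqrt_nonneg _)).2 fun t => ?_
        refine Real.le_sqrt_of_sq_le ?_
        rw [objective_eq h] at hbC
        have h3 : 0 ≤ ∑ j, q |b j| := Finset.sum_nonneg fun j _ => h.nonneg (abs_nonneg _)
        have h4 : (2 * (T : ℝ))⁻¹ * (∑ t, (y t - (X *ᵥ b) t) ^ 2) ≤ C := by linarith
        rw [inv_mul_le_iff₀ (by positivity)] at h4
        refine le_trans ?_ h4
        rw [Real.norm_eq_abs, sq_abs]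
        exact Finset.single_le_sum (f := fun t => (y t - (X *ᵥ b) t) ^ 2)
          (fun _ _ => sq_nonneg _) (Finset.mem_univ t)
      calc ‖X *ᵥ b‖ = ‖y - (y - X *ᵥ b)‖ := by rw [sub_sub_cancel]
        _ ≤ ‖y‖ + ‖y - X *ᵥ b‖ := norm_sub_le _ _
        _ ≤ _ := by linarith
    have hcomp : IsCompact ((V : Set (Fin p → ℝ)) ∩ Metric.closedBall 0 R) :=
      (isCompact_closedBall 0 R).inter_left hVc
    have h0 : (0 : Fin p → ℝ) ∈ (V : Set (Fin p → ℝ)) ∩ Metric.closedBall 0 R :=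
      ⟨V.zero_mem, by simpa using (norm_nonneg _).trans (hbound 0 V.zero_mem le_rfl)⟩
    obtain ⟨b, hb, hbmin⟩ := hcomp.exists_isMinOn ⟨0, h0⟩ (continuous_objective h X y).continuousOn
    refine ⟨b, hb.1, fun b' hb' => ?_⟩
    by_cases hle : objective q X y b' ≤ C
    · exact hbmin ⟨hb', by simpa using hbound b' hb' hle⟩
    · exact (hbmin h0).trans (le_of_not_ge hle)

/-- The objective attains its minimum over the `k`-sparse vectors. -/
theorem exists_min_sparse (h : IsFoldedConcave q lam μ) (hT : 0 < T)
    (X : Matrix (Fin T) (Fin p) ℝ) (y : Fin T → ℝ) (k : ℕ) :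
    ∃ b : Fin p → ℝ, l0 b ≤ k ∧ ∀ b', l0 b' ≤ k → objective q X y b ≤ objective q X y b' := by
  choose B hB hBmin using exists_min_supported h hT X y
  obtain ⟨J, hJ, hJmin⟩ := Finset.exists_min_image
    ((Finset.univ : Finset (Finset (Fin p))).filter fun J => J.card ≤ k)
    (fun J => objective q X y (B J)) ⟨∅, by simp⟩
  refine ⟨B J, ?_, fun b' hb' => ?_⟩
  · refine le_trans (Finset.card_le_card fun j hj => ?_) (Finset.mem_filter.1 hJ).2
    by_contra hc
    exact (Finset.mem_filter.1 hj).2 (hB J j hc)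
  · refine (hJmin (Finset.univ.filter fun j => b' j ≠ 0) (by
      rw [Finset.mem_filter]; exact ⟨Finset.mem_univ _, hb'⟩)).trans
      (hBmin _ b' fun j hj => by simpa using hj)

/-- The sparse vectors form a finite union of coordinate subspaces. -/
theorem isClosed_sparse (k : ℕ) : IsClosed {b : Fin p → ℝ | l0 b ≤ k} := by
  have : {b : Fin p → ℝ | l0 b ≤ k} = ⋃ J ∈ {J : Finset (Fin p) | J.card ≤ k},
      ⋂ j ∈ {j | j ∉ J}, {b : Fin p → ℝ | b j = 0} := by
    ext b
    simp only [Set.mem_ofPred_eq, Set.mem_iUnion, Set.mem_iInter, exists_prop]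
    constructor
    · intro hb
      exact ⟨Finset.univ.filter fun j => b j ≠ 0, hb, fun j hj => by simpa using hj⟩
    · rintro ⟨J, hJ, hb⟩
      refine le_trans (Finset.card_le_card fun j hj => ?_) hJ
      by_contra hc
      exact (Finset.mem_filter.1 hj).2 (hb j hc)
  rw [this]
  refine Set.Finite.isClosed_biUnion (Set.toFinite _) fun J _ =>
    isClosed_biInter fun j _ => isClosed_eq (continuous_apply j) continuous_const

end Minimizer

/-! ### Measurable selection of minimizers -/

section Selection

variable {Ω : Type*} [MeasurableSpace Ω] {p : ℕ}

/-- By compactness and continuity, a zero in `K` exists exactly when a countable dense subset of `K`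
contains points with arbitrarily small values. This avoids measurability of general projections. -/
theorem measurableSet_exists_zero {K : Set (Fin p → ℝ)} (hK : IsCompact K)
    {f : Ω → (Fin p → ℝ) → ℝ} (hm : ∀ b, Measurable fun ω => f ω b)
    (hc : ∀ ω, Continuous (f ω)) (h0 : ∀ ω b, 0 ≤ f ω b) :
    MeasurableSet {ω | ∃ b ∈ K, f ω b = 0} := by
  obtain ⟨D, hDc, hDd⟩ := TopologicalSpace.exists_countable_dense K
  have : {ω | ∃ b ∈ K, f ω b = 0} = ⋂ n : ℕ, ⋃ d ∈ D, {ω | f ω d < 1 / ((n : ℝ) + 1)} := by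
    ext ω
    simp only [Set.mem_ofPred_eq, Set.mem_iInter, Set.mem_iUnion, exists_prop]
    constructor
    · rintro ⟨b, hb, hb0⟩ n
      have hopen : IsOpen {x : K | f ω x < 1 / ((n : ℝ) + 1)} :=
        isOpen_lt ((hc ω).comp continuous_subtype_val) continuous_const
      obtain ⟨d, hd, hdD⟩ := hDd.inter_open_nonempty _ hopen
        ⟨⟨b, hb⟩, by simp only [Set.mem_ofPred_eq, hb0]; positivity⟩
      exact ⟨d, hdD, hd⟩
    · intro hn
      obtain ⟨d0, -, -⟩ := hn 0
      obtain ⟨b, hb, hbmin⟩ := hK.exists_isMinOn ⟨d0, d0.2⟩ (hc ω).continuousOn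
      refine ⟨b, hb, le_antisymm (le_of_forall_pos_lt_add fun ε hε => ?_) (h0 ω b)⟩
      obtain ⟨n, hnε⟩ := exists_nat_one_div_lt hε
      obtain ⟨d, -, hd⟩ := hn n
      have := hbmin d.2
      simp only [Set.mem_ofPred_eq] at this
      linarith
  rw [this]
  exact MeasurableSet.iInter fun n => MeasurableSet.biUnion hDc fun d _ =>
    measurableSet_lt (hm d) measurable_const

/-- A nonnegative Carathéodory function whose sections all vanish somewhere on a compact set has a
measurable selection of zeros. -/
theorem exists_measurable_zero {K : Set (Fin p → ℝ)} (hK : IsCompact K)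
    {f : Ω → (Fin p → ℝ) → ℝ} (hm : ∀ b, Measurable fun ω => f ω b)
    (hc : ∀ ω, Continuous (f ω)) (h0 : ∀ ω b, 0 ≤ f ω b) (hex : ∀ ω, ∃ b ∈ K, f ω b = 0) :
    ∃ β : Ω → Fin p → ℝ, Measurable β ∧ ∀ ω, β ω ∈ K ∧ f ω (β ω) = 0 := by
  -- Coordinates are fixed one at a time: each is taken to be the least value among the zeros that
  -- agree with the coordinates already chosen. The sublevel sets of this minimum are covered by
  -- `measurableSet_exists_zero`.
  have key : ∀ S : Finset (Fin p), ∃ β : Ω → Fin p → ℝ, Measurable β ∧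
      ∀ ω, ∃ b ∈ K, f ω b = 0 ∧ ∀ i ∈ S, b i = β ω i := by
    intro S
    induction S using Finset.induction_on with
    | empty => exact ⟨0, measurable_const, fun ω => by simpa using hex ω⟩
    | insert j S hj ih =>
      obtain ⟨β, hβ, hβe⟩ := ih
      set g : Ω → (Fin p → ℝ) → ℝ := fun ω b => f ω b + ∑ i ∈ S, |b i - β ω i| with hg
      have hgm : ∀ b, Measurable fun ω => g ω b := fun b => by
        refine (hm b).add (Finset.measurable_sum _ fun i _ => ?_)
        have : Measurable fun ω => β ω i := (measurable_pi_apply i).comp hβ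
        exact (measurable_const.sub this).abs
      have hgc : ∀ ω, Continuous (g ω) := fun ω => by
        have := hc ω
        fun_prop
      have hg0 : ∀ ω b, 0 ≤ g ω b := fun ω b =>
        add_nonneg (h0 ω b) (Finset.sum_nonneg fun _ _ => abs_nonneg _)
      have hgz : ∀ ω b, g ω b = 0 ↔ f ω b = 0 ∧ ∀ i ∈ S, b i = β ω i := fun ω b => by
        rw [hg]
        simp only
        rw [add_eq_zero_iff_of_nonneg (h0 ω b) (Finset.sum_nonneg fun _ _ => abs_nonneg _),
          Finset.sum_eq_zero_iff_of_nonneg fun _ _ => abs_nonneg _]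
        simp [sub_eq_zero]
      have hmin : ∀ ω, ∃ b ∈ K, g ω b = 0 ∧ ∀ b' ∈ K, g ω b' = 0 → b j ≤ b' j := fun ω => by
        have hcl : IsCompact (K ∩ {b | g ω b = 0}) :=
          hK.inter_right (isClosed_eq (hgc ω) continuous_const)
        obtain ⟨b, hb, hbe⟩ := hβe ω
        obtain ⟨b1, hb1, hmin⟩ := hcl.exists_isMinOn ⟨b, hb, (hgz ω b).2 hbe⟩
          (continuous_apply j).continuousOn
        exact ⟨b1, hb1.1, hb1.2, fun b' hb' hz => hmin ⟨hb', hz⟩⟩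
      choose B hBK hBz hBmin using hmin
      have hBm : Measurable fun ω => B ω j := by
        refine measurable_of_Iic fun c => ?_
        have : (fun ω => B ω j) ⁻¹' Set.Iic c =
            {ω | ∃ b ∈ K ∩ {b | b j ≤ c}, g ω b = 0} := by
          ext ω
          constructor
          · intro hω
            exact ⟨B ω, ⟨hBK ω, hω⟩, hBz ω⟩
          · rintro ⟨b, ⟨hb, hbc⟩, hbz⟩
            exact (hBmin ω b hb hbz).trans hbc
        rw [this]
        exact measurableSet_exists_zero
          (hK.inter_right (isClosed_le (continuous_apply j) continuous_const)) hgm hgc hg0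
      refine ⟨fun ω => Function.update (β ω) j (B ω j), ?_, fun ω => ?_⟩
      · refine measurable_pi_lambda _ fun i => ?_
        by_cases hij : i = j
        · subst hij; simpa using hBm
        · simp only [Function.update_of_ne hij]
          exact (measurable_pi_apply i).comp hβ
      · have hz := (hgz ω (B ω)).1 (hBz ω)
        refine ⟨B ω, hBK ω, hz.1, fun i hi => ?_⟩
        rcases Finset.mem_insert.1 hi with rfl | hi
        · simp
        · beta_reduce
          rw [Function.update_of_ne (fun hc : i = j => hj (hc ▸ hi))]
          exact hz.2 i hi
  obtain ⟨β, hβ, hβe⟩ := key Finset.univ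
  refine ⟨β, hβ, fun ω => ?_⟩
  obtain ⟨b, hb, hb0, hbe⟩ := hβe ω
  have : b = β ω := funext fun i => hbe i (Finset.mem_univ i)
  exact this ▸ ⟨hb, hb0⟩

/-- A Carathéodory function whose sections all attain their minimum on a closed set has a
measurable selection of minimizers. -/
theorem exists_measurable_argmin {F : Set (Fin p → ℝ)} (hF : IsClosed F)
    {f : Ω → (Fin p → ℝ) → ℝ} (hm : ∀ b, Measurable fun ω => f ω b)
    (hc : ∀ ω, Continuous (f ω)) (hex : ∀ ω, ∃ b ∈ F, ∀ b' ∈ F, f ω b ≤ f ω b') :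
    ∃ β : Ω → Fin p → ℝ, Measurable β ∧ ∀ ω, β ω ∈ F ∧ ∀ b' ∈ F, f ω (β ω) ≤ f ω b' := by
  classical
  rcases isEmpty_or_nonempty Ω with hΩ | ⟨⟨ω0⟩⟩
  · exact ⟨fun _ => 0, measurable_const, fun ω => hΩ.elim ω⟩
  choose B hBF hBmin using hex
  obtain ⟨D, hDc, hDd⟩ := TopologicalSpace.exists_countable_dense F
  have hv : Measurable fun ω => f ω (B ω) := by
    refine measurable_of_Iio fun c => ?_
    have : (fun ω => f ω (B ω)) ⁻¹' Set.Iio c = ⋃ d ∈ D, {ω | f ω d < c} := by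
      ext ω
      simp only [Set.mem_preimage, Set.mem_Iio, Set.mem_iUnion, Set.mem_ofPred_eq, exists_prop]
      constructor
      · intro hω
        have hopen : IsOpen {x : F | f ω x < c} :=
          isOpen_lt ((hc ω).comp continuous_subtype_val) continuous_const
        obtain ⟨d, hd, hdD⟩ := hDd.inter_open_nonempty _ hopen ⟨⟨B ω, hBF ω⟩, hω⟩
        exact ⟨d, hdD, hd⟩
      · rintro ⟨d, -, hd⟩
        exact (hBmin ω d d.2).trans_lt hd
    rw [this]
    exact MeasurableSet.biUnion hDc fun d _ => measurableSet_lt (hm d) measurable_const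
  set g : Ω → (Fin p → ℝ) → ℝ := fun ω b => |f ω b - f ω (B ω)| with hg
  have hgm : ∀ b, Measurable fun ω => g ω b := fun b => ((hm b).sub hv).abs
  have hgc : ∀ ω, Continuous (g ω) := fun ω => ((hc ω).sub continuous_const).abs
  -- The set `F` is exhausted by compact sets. Centring the balls at a point of `F` keeps every `K
  -- n` nonempty, so a selection into `K n` also exists for `ω` outside `A n`, where the indicator
  -- makes the condition vacuous.
  set K : ℕ → Set (Fin p → ℝ) := fun n => F ∩ Metric.closedBall (B ω0) n with hK
  have hKc : ∀ n, IsCompact (K n) := fun n => (isCompact_closedBall _ _).inter_left hF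
  set A : ℕ → Set Ω := fun n => {ω | ∃ b ∈ K n, g ω b = 0} with hA
  have hAm : ∀ n, MeasurableSet (A n) := fun n =>
    measurableSet_exists_zero (hKc n) hgm hgc fun _ _ => abs_nonneg _
  have hAex : ∀ ω, ∃ n, ω ∈ A n := fun ω => by
    obtain ⟨n, hn⟩ := exists_nat_ge (dist (B ω) (B ω0))
    exact ⟨n, B ω, ⟨hBF ω, hn⟩, by simp [hg]⟩
  have hsel : ∀ n, ∃ β : Ω → Fin p → ℝ, Measurable β ∧
      ∀ ω, β ω ∈ K n ∧ (A n).indicator (fun ω => g ω (β ω)) ω = 0 := fun n => by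
    obtain ⟨β, hβ, hβ'⟩ := exists_measurable_zero (hKc n)
      (f := fun ω b => (A n).indicator (fun ω => g ω b) ω)
      (fun b => (hgm b).indicator (hAm n))
      (fun ω => by
        by_cases hω : ω ∈ A n
        · simpa [hω] using hgc ω
        · simp [hω, continuous_const])
      (fun ω b => Set.indicator_nonneg (fun _ _ => abs_nonneg _) ω)
      (fun ω => by
        by_cases hω : ω ∈ A n
        · obtain ⟨b, hb, hb0⟩ := hω
          exact ⟨b, hb, Set.indicator_apply_eq_zero.2 fun _ => hb0⟩
        · exact ⟨B ω0, ⟨hBF ω0, by simp⟩, by simp [hω]⟩)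
    refine ⟨β, hβ, fun ω => ⟨(hβ' ω).1, ?_⟩⟩
    have := (hβ' ω).2
    exact this
  choose β hβ hβ' using hsel
  refine ⟨fun ω => β (Nat.find (hAex ω)) ω, Measurable.find hβ hAm hAex, fun ω => ?_⟩
  have h1 := hβ' (Nat.find (hAex ω)) ω
  refine ⟨h1.1.1, fun b' hb' => ?_⟩
  have h2 := h1.2
  rw [Set.indicator_of_mem (Nat.find_spec (hAex ω))] at h2
  rw [sub_eq_zero.1 (abs_eq_zero.1 h2)]
  exact hBmin ω b' hb'

end Selection

end PenalizedTS

/-! ### Exponential moments of Gaussian quadratic forms -/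

namespace PenalizedTS

theorem lintegral_exp_sq_gaussianReal {c : ℝ} (hc : c < 1 / 2) :
    ∫⁻ x, ENNReal.ofReal (Real.exp (c * x ^ 2)) ∂(gaussianReal 0 1)
      = ENNReal.ofReal (Real.sqrt (1 - 2 * c))⁻¹ := by
  have hb : 0 < 1 / 2 - c := by linarith
  rw [gaussianReal_of_var_ne_zero 0 one_ne_zero,
    lintegral_withDensity_eq_lintegral_mul _ (measurable_gaussianPDF 0 1) (by fun_prop)]
  have h1 : ∀ x : ℝ, (gaussianPDF 0 1 * fun x => ENNReal.ofReal (Real.exp (c * x ^ 2))) x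
      = ENNReal.ofReal ((Real.sqrt (2 * Real.pi))⁻¹ * Real.exp (-(1 / 2 - c) * x ^ 2)) := by
    intro x
    rw [Pi.mul_apply, gaussianPDF, ← ENNReal.ofReal_mul (gaussianPDFReal_nonneg 0 1 x),
      gaussianPDFReal_def, mul_assoc, ← Real.exp_add]
    congr 2
    · simp
    · congr 1
      simp
      ring
  simp_rw [h1]
  rw [← ofReal_integral_eq_lintegral_ofReal ((integrable_exp_neg_mul_sq hb).const_mul _)
    (ae_of_all _ fun x => by positivity), integral_const_mul, integral_gaussian]
  congr 1
  rw [← Real.sqrt_inv, ← Real.sqrt_inv, ← Real.sqrt_mul (by positivity)]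
  congr 1
  have hpi := Real.pi_ne_zero
  have h3 : 1 - 2 * c ≠ 0 := by linarith
  have h4 : (1 : ℝ) / 2 - c ≠ 0 := hb.ne'
  field_simp

theorem lintegral_exp_mul_gaussianReal (t : ℝ) :
    ∫⁻ x, ENNReal.ofReal (Real.exp (t * x)) ∂(gaussianReal 0 1)
      = ENNReal.ofReal (Real.exp (t ^ 2 / 2)) := by
  rw [← ofReal_integral_eq_lintegral_ofReal (integrable_exp_mul_gaussianReal t)
    (ae_of_all _ fun x => by positivity)]
  have := congrFun (mgf_id_gaussianReal (μ := 0) (v := 1)) t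
  simp only [mgf, id] at this
  rw [this]
  simp

variable {Ω : Type*} [MeasurableSpace Ω] {P : Measure Ω} {ι : Type*}

/-- A family of independent standard normal random variables. -/
structure IsStdGaussian (W : ι → Ω → ℝ) (P : Measure Ω) : Prop where
  meas : ∀ k, Measurable (W k)
  law : ∀ k, P.map (W k) = gaussianReal 0 1
  indep : iIndepFun W P

namespace IsStdGaussian

variable {W : ι → Ω → ℝ}

theorem hasGaussianLaw_single (h : IsStdGaussian W P) (k : ι) : HasGaussianLaw (W k) P where
  isGaussian_map := by rw [h.law k]; infer_instance

theorem memLp_single (h : IsStdGaussian W P) (k : ι) : MemLp (W k) 2 P :=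
  (h.hasGaussianLaw_single k).memLp_two

theorem integral_single (h : IsStdGaussian W P) (k : ι) : P[W k] = 0 := by
  have := integral_map (μ := P) (h.meas k).aemeasurable
    (f := fun x : ℝ => x) (by fun_prop)
  rw [← this, h.law k, integral_id_gaussianReal]

theorem variance_single (h : IsStdGaussian W P) (k : ι) : Var[W k; P] = 1 := by
  have := variance_map (μ := P) (X := id) (Y := W k) aemeasurable_id (h.meas k).aemeasurable
  rw [h.law k, variance_id_gaussianReal] at this
  simpa using this.symm

end IsStdGaussian

variable [Fintype ι]

/-- The linear combination of the family `W` with coefficients `a`. -/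
def lin (W : ι → Ω → ℝ) (a : ι → ℝ) (ω : Ω) : ℝ := ∑ k, a k * W k ω

theorem exp_markov {f : Ω → ℝ} (hf : Measurable f) {B : ℝ}
    (h : ∫⁻ ω, ENNReal.ofReal (Real.exp (f ω)) ∂P ≤ ENNReal.ofReal B) (x : ℝ) :
    P {ω | x ≤ f ω} ≤ ENNReal.ofReal (B * Real.exp (-x)) := by
  have h1 : {ω | x ≤ f ω} = {ω | ENNReal.ofReal (Real.exp x) ≤ ENNReal.ofReal (Real.exp (f ω))} := by
    ext ω
    simp [ENNReal.ofReal_le_ofReal_iff (Real.exp_pos _).le]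
  rw [h1]
  refine (meas_ge_le_lintegral_div (by fun_prop) (by simpa using Real.exp_pos x)
    ENNReal.ofReal_ne_top).trans ?_
  rw [Real.exp_neg, ← div_eq_mul_inv, ENNReal.ofReal_div_of_pos (Real.exp_pos x)]
  exact ENNReal.div_le_div_right h _

namespace IsStdGaussian

variable {W : ι → Ω → ℝ}

theorem measurable_lin (h : IsStdGaussian W P) (a : ι → ℝ) : Measurable (lin W a) :=
  Finset.measurable_sum _ fun k _ => measurable_const.mul (h.meas k)

theorem hasGaussianLaw_lin_pi (h : IsStdGaussian W P) {τ : Type*} [Fintype τ] (a : τ → ι → ℝ) :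
    HasGaussianLaw (fun ω t => lin W (a t) ω) P := by
  let L : (ι → ℝ) →L[ℝ] (τ → ℝ) := ContinuousLinearMap.pi fun t =>
    ∑ k, a t k • ContinuousLinearMap.proj k
  have := (iIndepFun.hasGaussianLaw h.hasGaussianLaw_single h.indep).map_fun L
  have e : (fun ω => L fun k => W k ω) = fun ω t => lin W (a t) ω := by
    ext ω t; simp [L, lin]
  rwa [e] at this

/-- Joint Gaussianity of two blocks is what makes vanishing cross-covariances imply their
independence in `indepFun_lin`. -/
theorem hasGaussianLaw_lin_prod (h : IsStdGaussian W P) {τ τ' : Type*} [Fintype τ] [Fintype τ']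
    (a : τ → ι → ℝ) (b : τ' → ι → ℝ) :
    HasGaussianLaw (fun ω => ((fun t => lin W (a t) ω), fun t => lin W (b t) ω)) P := by
  let L : (ι → ℝ) →L[ℝ] (τ → ℝ) := ContinuousLinearMap.pi fun t =>
    ∑ k, a t k • ContinuousLinearMap.proj k
  let L' : (ι → ℝ) →L[ℝ] (τ' → ℝ) := ContinuousLinearMap.pi fun t =>
    ∑ k, b t k • ContinuousLinearMap.proj k
  have := (iIndepFun.hasGaussianLaw h.hasGaussianLaw_single h.indep).map_fun (L.prod L')
  have e : (fun ω => (L.prod L') fun k => W k ω) =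
      fun ω => ((fun t => lin W (a t) ω), fun t => lin W (b t) ω) := by
    ext ω t <;> simp [L, L', lin]
  rwa [e] at this

theorem hasGaussianLaw_lin (h : IsStdGaussian W P) (a : ι → ℝ) : HasGaussianLaw (lin W a) P :=
  (h.hasGaussianLaw_lin_pi (τ := Unit) fun _ => a).eval ()

theorem integral_lin (h : IsStdGaussian W P) (a : ι → ℝ) : P[lin W a] = 0 := by
  have := h.indep.isProbabilityMeasure
  simp only [lin]
  rw [integral_finsetSum _ fun k _ => ((h.memLp_single k).integrable (by norm_num)).const_mul _]
  refine Finset.sum_eq_zero fun k _ => ?_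
  rw [integral_const_mul, h.integral_single, mul_zero]

theorem covariance_lin (h : IsStdGaussian W P) (a b : ι → ℝ) :
    cov[lin W a, lin W b; P] = ∑ k, a k * b k := by
  classical
  have := h.indep.isProbabilityMeasure
  have e : ∀ c : ι → ℝ, lin W c = fun ω => ∑ k, c k * W k ω := fun c => rfl
  rw [e, e, covariance_fun_sum_fun_sum (fun k => (h.memLp_single k).const_mul _)
    fun k => (h.memLp_single k).const_mul _]
  refine Finset.sum_congr rfl fun k _ => ?_
  rw [Finset.sum_eq_single k]
  · rw [covariance_const_mul_left, covariance_const_mul_right,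
      covariance_self (h.meas k).aemeasurable, h.variance_single, mul_one]
  · intro l _ hl
    rw [covariance_const_mul_left, covariance_const_mul_right,
      (h.indep.indepFun hl.symm).covariance_eq_zero (h.memLp_single k) (h.memLp_single l)]
    simp
  · simp

theorem integral_lin_mul_lin (h : IsStdGaussian W P) (a b : ι → ℝ) :
    ∫ ω, lin W a ω * lin W b ω ∂P = ∑ k, a k * b k := by
  have := h.indep.isProbabilityMeasure
  have h1 := covariance_eq_sub (h.hasGaussianLaw_lin a).memLp_two (h.hasGaussianLaw_lin b).memLp_two
  rw [h.covariance_lin, h.integral_lin, zero_mul, sub_zero] at h1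
  exact h1.symm

theorem map_lin (h : IsStdGaussian W P) (a : ι → ℝ) :
    P.map (lin W a) = gaussianReal 0 (∑ k, a k ^ 2).toNNReal := by
  rw [(h.hasGaussianLaw_lin a).map_eq_gaussianReal, h.integral_lin,
    ← covariance_self (h.measurable_lin a).aemeasurable, h.covariance_lin]
  simp only [sq]

theorem lintegral_exp_sq_lin (h : IsStdGaussian W P) (a : ι → ℝ) {c : ℝ}
    (hc : c * ∑ k, a k ^ 2 < 1 / 2) :
    ∫⁻ ω, ENNReal.ofReal (Real.exp (c * lin W a ω ^ 2)) ∂P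
      = ENNReal.ofReal (Real.sqrt (1 - 2 * (c * ∑ k, a k ^ 2)))⁻¹ := by
  set v := ∑ k, a k ^ 2 with hv
  have hv0 : 0 ≤ v := Finset.sum_nonneg fun _ _ => sq_nonneg _
  have h1 : P.map (lin W a) = (gaussianReal 0 1).map (fun x => Real.sqrt v * x) := by
    rw [h.map_lin, gaussianReal_map_const_mul]
    congr 1
    · simp
    · ext
      simp [Real.sq_sqrt hv0, hv0, ← hv]
  rw [← lintegral_exp_sq_gaussianReal hc, ← lintegral_map
    (f := fun x : ℝ => ENNReal.ofReal (Real.exp (c * x ^ 2))) (by fun_prop) (h.measurable_lin a),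
    h1, lintegral_map (by fun_prop) (by fun_prop)]
  refine lintegral_congr fun x => ?_
  rw [mul_pow, Real.sq_sqrt hv0, mul_assoc]

theorem iIndepFun_lin (h : IsStdGaussian W P) {τ : Type*} [Fintype τ] (a : τ → ι → ℝ)
    (ha : ∀ s t, s ≠ t → ∑ k, a s k * a t k = 0) : iIndepFun (fun t => lin W (a t)) P :=
  (h.hasGaussianLaw_lin_pi a).iIndepFun_of_covariance_eq_zero fun s t hst => by
    rw [h.covariance_lin, ha s t hst]

theorem indepFun_lin (h : IsStdGaussian W P) {τ τ' : Type*} [Fintype τ] [Fintype τ']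
    (a : τ → ι → ℝ) (b : τ' → ι → ℝ) (hab : ∀ s t, ∑ k, a s k * b t k = 0) :
    IndepFun (fun ω s => lin W (a s) ω) (fun ω t => lin W (b t) ω) P :=
  (h.hasGaussianLaw_lin_prod a b).indepFun_of_covariance_eval fun s t => by
    rw [h.covariance_lin, hab s t]

/-- The Laplace transform of a weighted sum of squares of independent normal variables with the
same variance. -/
theorem lintegral_exp_sum_sq_lin (h : IsStdGaussian W P) {τ : Type*} [Fintype τ] (a : τ → ι → ℝ)
    (ha : ∀ s t, s ≠ t → ∑ k, a s k * a t k = 0) {v c : ℝ} (hv : ∀ t, ∑ k, a t k ^ 2 = v)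
    (hc : c * v < 1 / 2) :
    ∫⁻ ω, ENNReal.ofReal (Real.exp (c * ∑ t, lin W (a t) ω ^ 2)) ∂P
      = ENNReal.ofReal ((Real.sqrt (1 - 2 * (c * v)))⁻¹ ^ Fintype.card τ) := by
  have h1 : ∀ ω, ENNReal.ofReal (Real.exp (c * ∑ t, lin W (a t) ω ^ 2)) =
      ∏ t, ENNReal.ofReal (Real.exp (c * lin W (a t) ω ^ 2)) := fun ω => by
    rw [Finset.mul_sum, Real.exp_sum, ENNReal.ofReal_prod_of_nonneg fun _ _ => (Real.exp_pos _).le]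
  simp_rw [h1]
  rw [lintegral_prod_eq_prod_lintegral_of_indepFun Finset.univ
    (fun t ω => ENNReal.ofReal (Real.exp (c * lin W (a t) ω ^ 2)))
    ((h.iIndepFun_lin a ha).comp (fun _ x => ENNReal.ofReal (Real.exp (c * x ^ 2)))
      fun _ => by fun_prop)
    fun t => by have := h.measurable_lin (a t); fun_prop]
  rw [Finset.prod_congr rfl fun t _ => by
    rw [h.lintegral_exp_sq_lin (a t) (by rw [hv t]; exact hc), hv t]]
  rw [Finset.prod_const, Finset.card_univ, ENNReal.ofReal_pow (by positivity)]

/-- The exponential moment of a decoupled Gaussian chaos of order two, in terms of its variance. -/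
theorem lintegral_exp_chaos (h : IsStdGaussian W P) {τ : Type*} [Fintype τ] (b e : τ → ι → ℝ)
    (hbe : ∀ s t, ∑ k, b s k * e t k = 0) (he : ∀ s t, s ≠ t → ∑ k, e s k * e t k = 0)
    (he1 : ∀ t, ∑ k, e t k ^ 2 = 1) {θ V : ℝ} (hV : ∑ t, ∑ k, b t k ^ 2 ≤ V)
    (hθ : θ ^ 2 * V ≤ 1 / 2) :
    ∫⁻ ω, ENNReal.ofReal (Real.exp (θ * ∑ t, lin W (b t) ω * lin W (e t) ω)) ∂P
      ≤ ENNReal.ofReal (Real.sqrt 2) := by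
  have hprob := h.indep.isProbabilityMeasure
  -- integrate out the second factor
  have hcond : ∫⁻ ω, ENNReal.ofReal (Real.exp (θ * ∑ t, lin W (b t) ω * lin W (e t) ω)) ∂P
      = ∫⁻ ω, ENNReal.ofReal (Real.exp (θ ^ 2 / 2 * ∑ t, lin W (b t) ω ^ 2)) ∂P := by
    have hY : Measurable fun ω t => lin W (b t) ω :=
      measurable_pi_lambda _ fun t => h.measurable_lin (b t)
    have hz : Measurable fun ω t => lin W (e t) ω :=
      measurable_pi_lambda _ fun t => h.measurable_lin (e t)
    have hprod := (indepFun_iff_map_prod_eq_prod_map_map hY.aemeasurable hz.aemeasurable).1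
      (h.indepFun_lin b e hbe)
    have hF : Measurable fun x : (τ → ℝ) × (τ → ℝ) =>
        ENNReal.ofReal (Real.exp (θ * ∑ t, x.1 t * x.2 t)) := by fun_prop
    have e1 := lintegral_map (μ := P) hF (hY.prodMk hz)
    simp only at e1
    rw [← e1, hprod, lintegral_prod _ hF.aemeasurable, lintegral_map hF.lintegral_prod_right' hY]
    refine lintegral_congr fun ω => ?_
    rw [lintegral_map (by fun_prop) hz]
    have e2 : ∀ ω', ENNReal.ofReal (Real.exp (θ * ∑ t, lin W (b t) ω * lin W (e t) ω')) =
        ∏ t, ENNReal.ofReal (Real.exp (θ * lin W (b t) ω * lin W (e t) ω')) := fun ω' => by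
      rw [Finset.mul_sum, Real.exp_sum,
        ENNReal.ofReal_prod_of_nonneg fun _ _ => (Real.exp_pos _).le]
      simp only [mul_assoc]
    simp_rw [e2]
    rw [lintegral_prod_eq_prod_lintegral_of_indepFun Finset.univ
      (fun t ω' => ENNReal.ofReal (Real.exp (θ * lin W (b t) ω * lin W (e t) ω')))
      ((h.iIndepFun_lin e he).comp
        (fun t x => ENNReal.ofReal (Real.exp (θ * lin W (b t) ω * x))) fun _ => by fun_prop)
      fun t => by have := h.measurable_lin (e t); fun_prop]
    have e3 : ∀ t, ∫⁻ ω', ENNReal.ofReal (Real.exp (θ * lin W (b t) ω * lin W (e t) ω')) ∂P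
        = ENNReal.ofReal (Real.exp ((θ * lin W (b t) ω) ^ 2 / 2)) := fun t => by
      rw [← lintegral_exp_mul_gaussianReal, ← lintegral_map
        (f := fun x : ℝ => ENNReal.ofReal (Real.exp (θ * lin W (b t) ω * x))) (by fun_prop)
        (h.measurable_lin (e t)), h.map_lin, he1 t, Real.toNNReal_one]
    simp_rw [e3]
    rw [← ENNReal.ofReal_prod_of_nonneg fun _ _ => (Real.exp_pos _).le, ← Real.exp_sum,
      Finset.mul_sum]
    congr 2
    exact Finset.sum_congr rfl fun t _ => by ring
  rw [hcond]
  set v : τ → ℝ := fun t => ∑ k, b t k ^ 2 with hv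
  have hv0 : ∀ t, 0 ≤ v t := fun t => Finset.sum_nonneg fun _ _ => sq_nonneg _
  have hvzero : ∀ t, v t = 0 → ∀ ω, lin W (b t) ω = 0 := fun t ht ω => by
    have := (Finset.sum_eq_zero_iff_of_nonneg fun k _ => sq_nonneg (b t k)).1 ht
    exact Finset.sum_eq_zero fun k hk => by rw [pow_eq_zero_iff two_ne_zero |>.1 (this k hk), zero_mul]
  set V' := ∑ t, v t with hV'
  have hV'0 : 0 ≤ V' := Finset.sum_nonneg fun t _ => hv0 t
  rcases eq_or_lt_of_le hV'0 with h0 | hpos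
  · have hz : ∀ t ω, lin W (b t) ω = 0 := fun t =>
      hvzero t ((Finset.sum_eq_zero_iff_of_nonneg fun t _ => hv0 t).1 h0.symm t (Finset.mem_univ t))
    simp only [hz]
    simp
  have hθ' : θ ^ 2 * V' ≤ 1 / 2 := (mul_le_mul_of_nonneg_left hV (sq_nonneg θ)).trans hθ
  -- The variables `lin W (b t)` may be dependent. Convexity of `exp` with weights proportional to
  -- their variances reduces the joint moment to one-dimensional ones, without diagonalizing the
  -- quadratic form. Each normalized term has moment at most `(1 - θ² V')^{-1/2} ≤ √2`.
  have hjensen : ∀ ω, Real.exp (θ ^ 2 / 2 * ∑ t, lin W (b t) ω ^ 2) ≤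
      ∑ t, v t / V' * Real.exp (θ ^ 2 / 2 * (V' / v t) * lin W (b t) ω ^ 2) := fun ω => by
    have key := convexOn_exp.map_sum_le (t := Finset.univ) (w := fun t => v t / V')
      (p := fun t => θ ^ 2 / 2 * (V' / v t) * lin W (b t) ω ^ 2)
      (fun t _ => div_nonneg (hv0 t) hpos.le)
      (by rw [← Finset.sum_div, ← hV', div_self hpos.ne']) (fun _ _ => Set.mem_univ _)
    simp only [smul_eq_mul] at key
    refine le_trans (le_of_eq ?_) key
    congr 1
    rw [Finset.mul_sum]
    refine Finset.sum_congr rfl fun t _ => ?_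
    rcases eq_or_lt_of_le (hv0 t) with ht | ht
    · rw [hvzero t ht.symm ω]; simp
    · field_simp
  have hterm : ∀ t, ∫⁻ ω, ENNReal.ofReal
      (v t / V' * Real.exp (θ ^ 2 / 2 * (V' / v t) * lin W (b t) ω ^ 2)) ∂P
      ≤ ENNReal.ofReal (v t / V' * Real.sqrt 2) := fun t => by
    have hw : 0 ≤ v t / V' := div_nonneg (hv0 t) hpos.le
    have hcv : θ ^ 2 / 2 * (V' / v t) * v t ≤ 1 / 4 := by
      rcases eq_or_lt_of_le (hv0 t) with ht | ht
      · rw [← ht]; norm_num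
      · have : θ ^ 2 / 2 * (V' / v t) * v t = θ ^ 2 * V' / 2 := by field_simp
        linarith
    simp_rw [ENNReal.ofReal_mul hw]
    rw [lintegral_const_mul _ (by have := h.measurable_lin (b t); fun_prop),
      h.lintegral_exp_sq_lin (b t) (by change _ * v t < _; linarith)]
    gcongr
    change (Real.sqrt (1 - 2 * (_ * v t)))⁻¹ ≤ _
    rw [← Real.sqrt_inv]
    refine Real.sqrt_le_sqrt ?_
    rw [inv_le_comm₀ (by linarith) (by norm_num)]
    linarith
  calc ∫⁻ ω, ENNReal.ofReal (Real.exp (θ ^ 2 / 2 * ∑ t, lin W (b t) ω ^ 2)) ∂P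
      ≤ ∫⁻ ω, ∑ t, ENNReal.ofReal
          (v t / V' * Real.exp (θ ^ 2 / 2 * (V' / v t) * lin W (b t) ω ^ 2)) ∂P := by
        refine lintegral_mono fun ω => ?_
        rw [← ENNReal.ofReal_sum_of_nonneg fun t _ =>
          mul_nonneg (div_nonneg (hv0 t) hpos.le) (Real.exp_pos _).le]
        exact ENNReal.ofReal_le_ofReal (hjensen ω)
    _ = ∑ t, ∫⁻ ω, ENNReal.ofReal
          (v t / V' * Real.exp (θ ^ 2 / 2 * (V' / v t) * lin W (b t) ω ^ 2)) ∂P :=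
        lintegral_finsetSum _ fun t _ => by have := h.measurable_lin (b t); fun_prop
    _ ≤ ∑ t, ENNReal.ofReal (v t / V' * Real.sqrt 2) := Finset.sum_le_sum fun t _ => hterm t
    _ = ENNReal.ofReal (Real.sqrt 2) := by
        rw [← ENNReal.ofReal_sum_of_nonneg fun t _ =>
          mul_nonneg (div_nonneg (hv0 t) hpos.le) (Real.sqrt_nonneg _), ← Finset.sum_mul,
          ← Finset.sum_div, ← hV', div_self hpos.ne', one_mul]

/-- Exponential tail bound for a decoupled Gaussian chaos of order two. -/
theorem measure_chaos_ge_le (h : IsStdGaussian W P) {τ : Type*} [Fintype τ] (b e : τ → ι → ℝ)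
    (hbe : ∀ s t, ∑ k, b s k * e t k = 0) (he : ∀ s t, s ≠ t → ∑ k, e s k * e t k = 0)
    (he1 : ∀ t, ∑ k, e t k ^ 2 = 1) {θ V : ℝ} (hθ0 : 0 ≤ θ) (hV : ∑ t, ∑ k, b t k ^ 2 ≤ V)
    (hθ : θ ^ 2 * V ≤ 1 / 2) (x : ℝ) :
    P {ω | x ≤ |∑ t, lin W (b t) ω * lin W (e t) ω|}
      ≤ ENNReal.ofReal (3 * Real.exp (-(θ * x))) := by
  have hm : Measurable fun ω => ∑ t, lin W (b t) ω * lin W (e t) ω :=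
    Finset.measurable_sum _ fun t _ => (h.measurable_lin _).mul (h.measurable_lin _)
  have h1 := exp_markov (P := P) (hm.const_mul θ) (h.lintegral_exp_chaos b e hbe he he1 hV hθ) (θ * x)
  have h2 := exp_markov (P := P) (hm.const_mul (-θ))
    (h.lintegral_exp_chaos b e hbe he he1 hV (by rwa [neg_sq])) (θ * x)
  have hsub : {ω | x ≤ |∑ t, lin W (b t) ω * lin W (e t) ω|} ⊆
      {ω | θ * x ≤ θ * ∑ t, lin W (b t) ω * lin W (e t) ω} ∪
      {ω | θ * x ≤ -θ * ∑ t, lin W (b t) ω * lin W (e t) ω} := by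
    intro ω hω
    rcases le_abs.1 (show x ≤ _ from hω) with h | h
    · exact Or.inl (mul_le_mul_of_nonneg_left h hθ0)
    · exact Or.inr (by
        have := mul_le_mul_of_nonneg_left h hθ0
        simpa using this)
  refine (measure_mono hsub).trans ((measure_union_le _ _).trans ((add_le_add h1 h2).trans ?_))
  rw [← ENNReal.ofReal_add (by positivity) (by positivity)]
  refine ENNReal.ofReal_le_ofReal ?_
  have : Real.sqrt 2 ≤ 3 / 2 := Real.sqrt_le_iff.2 ⟨by norm_num, by norm_num⟩
  have h3 := mul_le_mul_of_nonneg_right this (Real.exp_pos (-(θ * x))).le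
  linarith

end IsStdGaussian

end PenalizedTS

/-! ### Matrix inequalities and nets of sparse vectors -/

namespace PenalizedTS

section Matrices

open scoped MatrixOrder in
theorem mul_dotProduct_le_of_le_eigenvalues {n : Type*} [Fintype n] [DecidableEq n]
    {A : Matrix n n ℝ} (hA : A.IsHermitian) {c : ℝ} (hc : ∀ i, c ≤ hA.eigenvalues i)
    (v : n → ℝ) : c * (v ⬝ᵥ v) ≤ v ⬝ᵥ (A *ᵥ v) := by
  have h1 : algebraMap ℝ (Matrix n n ℝ) c ≤ A := by
    rw [algebraMap_le_iff_le_spectrum (ha := hA)]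
    intro x hx
    rw [hA.spectrum_real_eq_range_eigenvalues] at hx
    obtain ⟨i, rfl⟩ := hx
    exact hc i
  have h2 := (Matrix.le_iff.1 h1).dotProduct_mulVec_nonneg v
  simp only [star_trivial, sub_mulVec, Algebra.algebraMap_eq_smul_one, smul_mulVec, one_mulVec,
    dotProduct_sub, dotProduct_smul, smul_eq_mul, sub_nonneg] at h2
  exact h2

variable {m n : Type*} [Fintype m] [Fintype n]

theorem l2_eq_norm (v : n → ℝ) : l2 v = ‖WithLp.toLp 2 v‖ := by
  rw [EuclideanSpace.norm_eq, l2]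
  simp

theorem l2_sq_eq_dotProduct (v : n → ℝ) : l2 v ^ 2 = v ⬝ᵥ v := by
  rw [l2_sq]
  exact Finset.sum_congr rfl fun j _ => sq (v j)

theorem l2_sq_mulVec (B : Matrix m n ℝ) (v : n → ℝ) :
    l2 (B *ᵥ v) ^ 2 = v ⬝ᵥ ((Bᵀ * B) *ᵥ v) := by
  rw [l2_sq_eq_dotProduct, ← mulVec_mulVec, dotProduct_mulVec v, vecMul_transpose]

theorem l2_sub_le (v w : n → ℝ) : l2 v - l2 w ≤ l2 (v - w) := by
  simp only [l2_eq_norm]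
  exact norm_sub_norm_le _ _

theorem l2_smul (c : ℝ) (v : n → ℝ) : l2 (c • v) = |c| * l2 v := by
  simp only [l2_eq_norm]
  exact norm_smul c (WithLp.toLp 2 v)

theorem l2_le_l1 (v : n → ℝ) : l2 v ≤ l1 v := by
  rw [l2]
  refine Real.sqrt_le_iff.2 ⟨Finset.sum_nonneg fun _ _ => abs_nonneg _, ?_⟩
  have := Finset.sum_sq_le_sq_sum_of_nonneg (s := Finset.univ) (f := fun j => |v j|)
    fun _ _ => abs_nonneg _
  simpa [l1] using this

theorem abs_le_l2 (v : n → ℝ) (j : n) : |v j| ≤ l2 v := by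
  refine Real.le_sqrt_of_sq_le ?_
  rw [sq_abs]
  exact Finset.single_le_sum (f := fun j => v j ^ 2) (fun _ _ => sq_nonneg _) (Finset.mem_univ j)

theorem l2_mulVec_le (B : Matrix m n ℝ) (d : n → ℝ) {C : ℝ}
    (hC : ∀ j, l2 (fun t => B t j) ≤ C) : l2 (B *ᵥ d) ≤ l1 d * C := by
  have h1 : WithLp.toLp 2 (B *ᵥ d) = ∑ j, d j • WithLp.toLp 2 (fun t => B t j) := by
    ext t
    simp [mulVec, dotProduct, mul_comm]
  rw [l2_eq_norm, h1, l1, Finset.sum_mul]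
  refine (norm_sum_le _ _).trans (Finset.sum_le_sum fun j _ => ?_)
  rw [norm_smul, ← l2_eq_norm]
  exact mul_le_mul_of_nonneg_left (hC j) (abs_nonneg _)

theorem l2_sq_mulVec_ge [DecidableEq n] {B : Matrix m n ℝ} (hB : (Bᵀ * B).IsHermitian) {c : ℝ}
    (hc : ∀ i, c ≤ hB.eigenvalues i) (v : n → ℝ) : c * l2 v ^ 2 ≤ l2 (B *ᵥ v) ^ 2 := by
  rw [l2_sq_mulVec, l2_sq_eq_dotProduct]
  exact mul_dotProduct_le_of_le_eigenvalues hB hc v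

/-- A lower bound on the eigenvalues of `B Bᵀ` is also one on those of `Bᵀ B`. -/
theorem l2_sq_mulVec_ge_of_posDef [DecidableEq n] {B : Matrix n n ℝ} (hB : (B * Bᵀ).PosDef)
    {c : ℝ} (hc0 : 0 < c) (hc : ∀ i, c ≤ hB.isHermitian.eigenvalues i) (w : n → ℝ) :
    c * l2 w ^ 2 ≤ l2 (B *ᵥ w) ^ 2 := by
  have hdet : IsUnit Bᵀ.det := by
    have h1 : (B * Bᵀ).det ≠ 0 := hB.det_pos.ne'
    rw [det_mul] at h1
    exact isUnit_iff_ne_zero.2 (right_ne_zero_of_mul h1)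
  -- Writing `w = Bᵀ x` gives `‖w‖² = ⟨B w, x⟩ ≤ ‖B w‖ ‖x‖`, and the eigenvalue bound for `B Bᵀ`
  -- controls `‖x‖` by `‖w‖`.
  obtain ⟨x, rfl⟩ : ∃ x, Bᵀ *ᵥ x = w :=
    ⟨Bᵀ⁻¹ *ᵥ w, by rw [mulVec_mulVec, mul_nonsing_inv _ hdet, one_mulVec]⟩
  set w := Bᵀ *ᵥ x with hw
  have h1 : c * l2 x ^ 2 ≤ l2 w ^ 2 := by
    rw [hw, l2_sq_mulVec, transpose_transpose, l2_sq_eq_dotProduct]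
    exact mul_dotProduct_le_of_le_eigenvalues hB.isHermitian hc x
  have h2 : l2 w ^ 2 = (B *ᵥ w) ⬝ᵥ x := by
    rw [l2_sq_eq_dotProduct]
    conv_lhs => rhs; rw [hw]
    rw [dotProduct_mulVec, vecMul_transpose]
  have h3 : (l2 w ^ 2) ^ 2 ≤ l2 (B *ᵥ w) ^ 2 * l2 x ^ 2 := by
    rw [h2, l2_sq, l2_sq]
    exact Finset.sum_mul_sq_le_sq_mul_sq Finset.univ (B *ᵥ w) x
  rcases eq_or_lt_of_le (sq_nonneg (l2 w)) with h0 | hpos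
  · rw [← h0, mul_zero]; exact sq_nonneg _
  refine le_of_mul_le_mul_right ?_ hpos
  calc c * l2 w ^ 2 * l2 w ^ 2 = c * (l2 w ^ 2) ^ 2 := by ring
    _ ≤ c * (l2 (B *ᵥ w) ^ 2 * l2 x ^ 2) := by gcongr
    _ = l2 (B *ᵥ w) ^ 2 * (c * l2 x ^ 2) := by ring
    _ ≤ _ := by gcongr

end Matrices

section Net

/-- A set of vectors that contains every vector with at most `m` nonzero entries and entries
in `G`. -/
noncomputable def sparseNet (p : ℕ) (G : Finset ℝ) : ℕ → Finset (Fin p → ℝ)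
  | 0 => {0}
  | m + 1 => Finset.image₂ (fun b (kg : Fin p × ℝ) => Function.update b kg.1 kg.2)
      (sparseNet p G m) (Finset.univ ×ˢ G)

theorem card_sparseNet_le (p : ℕ) (G : Finset ℝ) (m : ℕ) :
    (sparseNet p G m).card ≤ (p * G.card) ^ m := by
  induction m with
  | zero => simp [sparseNet]
  | succ m ih =>
    rw [sparseNet, pow_succ]
    refine (Finset.card_image₂_le _ _ _).trans ?_
    rw [Finset.card_product, Finset.card_univ, Fintype.card_fin]
    exact Nat.mul_le_mul_right _ ih

theorem mem_sparseNet {p : ℕ} (hp : 0 < p) {G : Finset ℝ} (hG : (0 : ℝ) ∈ G) {m : ℕ}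
    {v : Fin p → ℝ} (hv : l0 v ≤ m) (hvG : ∀ k, v k ∈ G) : v ∈ sparseNet p G m := by
  induction m generalizing v with
  | zero =>
    rw [sparseNet, Finset.mem_singleton]
    rw [Nat.le_zero, l0, Finset.card_eq_zero] at hv
    ext k
    by_contra hk
    have : k ∈ Finset.univ.filter fun j => v j ≠ 0 := by simpa using hk
    rw [hv] at this
    simp at this
  | succ m ih =>
    obtain ⟨k, hk⟩ : ∃ k, l0 (Function.update v k 0) ≤ m := by
      by_cases h : ∃ k, v k ≠ 0
      · obtain ⟨k, hk⟩ := h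
        refine ⟨k, ?_⟩
        have hsub : (Finset.univ.filter fun j => Function.update v k 0 j ≠ 0) ⊆
            (Finset.univ.filter fun j => v j ≠ 0).erase k := by
          intro j hj
          have hj' := (Finset.mem_filter.1 hj).2
          have hjk : j ≠ k := fun hc => hj' (by simp [hc])
          rw [Function.update_of_ne hjk] at hj'
          simp [hjk, hj']
        have h1 := Finset.card_le_card hsub
        rw [Finset.card_erase_of_mem (by simpa using hk)] at h1
        simp only [l0] at hv ⊢
        omega
      · push Not at h
        refine ⟨⟨0, hp⟩, ?_⟩
        have : v = 0 := funext h
        subst this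
        simp [l0]
    rw [sparseNet, Finset.mem_image₂]
    refine ⟨_, ih hk fun j => ?_, (k, v k), by simp [hvG], by simp⟩
    by_cases hjk : j = k
    · subst hjk; simpa using hG
    · rw [Function.update_of_ne hjk]; exact hvG j

/-- The multiples of `1 / N` in `[-1, 1]`. -/
noncomputable def grid (N : ℕ) : Finset ℝ :=
  (Finset.Icc (-(N : ℤ)) N).image fun n : ℤ => (n : ℝ) / N

theorem card_grid_le (N : ℕ) : (grid N).card ≤ 2 * N + 1 := by
  refine Finset.card_image_le.trans ?_
  rw [Int.card_Icc]
  omega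

theorem zero_mem_grid (N : ℕ) : (0 : ℝ) ∈ grid N :=
  Finset.mem_image.2 ⟨0, by simp, by simp⟩

theorem floor_div_mem_grid {N : ℕ} (hN : 0 < N) {x : ℝ} (hx : |x| ≤ 1) :
    (⌊(N : ℝ) * x⌋ : ℝ) / N ∈ grid N := by
  refine Finset.mem_image.2 ⟨⌊(N : ℝ) * x⌋, ?_, rfl⟩
  have hN' : (0 : ℝ) < N := by exact_mod_cast hN
  obtain ⟨h1, h2⟩ := abs_le.1 hx
  rw [Finset.mem_Icc]
  constructor
  · rw [Int.le_floor]; push_cast; nlinarith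
  · have h3 : (⌊(N : ℝ) * x⌋ : ℝ) ≤ N := (Int.floor_le _).trans (by nlinarith)
    exact_mod_cast h3

theorem abs_sub_floor_div_le {N : ℕ} (hN : 0 < N) (x : ℝ) :
    |x - (⌊(N : ℝ) * x⌋ : ℝ) / N| ≤ 1 / N := by
  have hN' : (0 : ℝ) < N := by exact_mod_cast hN
  have h1 := Int.floor_le ((N : ℝ) * x)
  have h2 := Int.lt_floor_add_one ((N : ℝ) * x)
  have h3 : x - (⌊(N : ℝ) * x⌋ : ℝ) / N = ((N : ℝ) * x - ⌊(N : ℝ) * x⌋) / N := by field_simp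
  rw [h3, abs_of_nonneg (div_nonneg (by linarith) hN'.le)]
  gcongr
  linarith

/-- A lower bound for `B` relative to `S` on the sparse grid vectors extends to all
sparse vectors. -/
theorem sparse_eigenvalue_of_net {T p m N : ℕ} (hp : 0 < p) (hN : 0 < N)
    {Z : Matrix (Fin T) (Fin p) ℝ} {S : Matrix (Fin p) (Fin p) ℝ} {cS C η : ℝ}
    (hcS : 0 < cS) (hC : 0 ≤ C)
    (hS : ∀ v, cS * l2 v ^ 2 ≤ l2 (S *ᵥ v) ^ 2)
    (hη : (m : ℝ) / N ≤ η) (hηC : Real.sqrt cS / 3 ≤ Real.sqrt (cS / 8) * (1 - η) - η * C)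
    (hnet : ∀ b ∈ sparseNet p (grid N) m,
      (T : ℝ) / 8 * l2 (S *ᵥ b) ^ 2 ≤ l2 (Z *ᵥ (S *ᵥ b)) ^ 2)
    (hcol : ∀ j, l2 (Z *ᵥ fun i => S i j) ≤ Real.sqrt T * C)
    (v : Fin p → ℝ) (hv : l0 v ≤ m) :
    cS / 9 * l2 v ^ 2 * T ≤ l2 (Z *ᵥ (S *ᵥ v)) ^ 2 := by
  have hunit : ∀ v : Fin p → ℝ, l0 v ≤ m → l2 v = 1 →
      Real.sqrt T * (Real.sqrt cS / 3) ≤ l2 (Z *ᵥ (S *ᵥ v)) := by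
    intro v hv hv1
    -- Rounding down to the grid sends `0` to `0`, so sparsity is kept and the `ℓ₁` error is at most
    -- `m / N`.
    set b : Fin p → ℝ := fun k => (⌊(N : ℝ) * v k⌋ : ℝ) / N with hb
    have hbz : ∀ k, v k = 0 → b k = 0 := fun k hk => by simp [hb, hk]
    have hbm : l0 b ≤ m := by
      refine (Finset.card_le_card fun k hk => ?_).trans hv
      rw [Finset.mem_filter] at hk ⊢
      exact ⟨hk.1, fun hc => hk.2 (hbz k hc)⟩
    have hbnet : b ∈ sparseNet p (grid N) m :=
      mem_sparseNet hp (zero_mem_grid N) hbm fun k =>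
        floor_div_mem_grid hN ((abs_le_l2 v k).trans hv1.le)
    have hd1 : l1 (v - b) ≤ η := by
      refine le_trans ?_ hη
      rw [l1, ← Finset.sum_filter_add_sum_filter_not Finset.univ fun k => v k ≠ 0]
      have e2 : ∑ k ∈ Finset.univ.filter (fun k => ¬ v k ≠ 0), |(v - b) k| = 0 :=
        Finset.sum_eq_zero fun k hk => by
          have : v k = 0 := by simpa using hk
          simp [this, hbz k this]
      rw [e2, add_zero]
      refine (Finset.sum_le_card_nsmul _ _ (1 / (N : ℝ)) fun k _ =>
        abs_sub_floor_div_le hN (v k)).trans ?_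
      rw [nsmul_eq_mul, mul_one_div]
      have : ((l0 v : ℕ) : ℝ) ≤ m := by exact_mod_cast hv
      exact div_le_div_of_nonneg_right this (Nat.cast_nonneg N)
    have hb1 : 1 - η ≤ l2 b := by
      have h1 := l2_sub_le v b
      have h2 := l2_le_l1 (v - b)
      linarith
    have hη1 : 0 ≤ 1 - η := by
      have h0 : 0 ≤ η := le_trans (by positivity) hη
      have h1 : 0 < Real.sqrt cS := Real.sqrt_pos.2 hcS
      have h2 : 0 < Real.sqrt (cS / 8) := Real.sqrt_pos.2 (by positivity)
      have h3 : 0 ≤ η * C := mul_nonneg h0 hC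
      by_contra! hneg
      nlinarith
    -- The net gives the bound at `b`. The rounding error costs its `ℓ₁` norm times the largest
    -- column norm of `Z S`, and `hηC` says that the constant `1/8` then degrades only to `1/9`.
    have hZb : Real.sqrt T * (Real.sqrt (cS / 8) * (1 - η)) ≤ l2 (Z *ᵥ (S *ᵥ b)) := by
      refine le_of_sq_le_sq ?_ (l2_nonneg _)
      rw [mul_pow, mul_pow, Real.sq_sqrt (Nat.cast_nonneg T), Real.sq_sqrt (by positivity)]
      calc (T : ℝ) * (cS / 8 * (1 - η) ^ 2) ≤ T * (cS / 8 * l2 b ^ 2) := by gcongr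
        _ = (T : ℝ) / 8 * (cS * l2 b ^ 2) := by ring
        _ ≤ (T : ℝ) / 8 * l2 (S *ᵥ b) ^ 2 := by gcongr; exact hS b
        _ ≤ _ := hnet b hbnet
    have hZd : l2 (Z *ᵥ (S *ᵥ (v - b))) ≤ η * (Real.sqrt T * C) := by
      rw [mulVec_mulVec]
      refine (l2_mulVec_le (Z * S) (v - b) (C := Real.sqrt T * C) fun j => hcol j).trans ?_
      gcongr
    have hdiff := l2_sub_le (Z *ᵥ (S *ᵥ b)) (Z *ᵥ (S *ᵥ (b - v)))
    have e1 : Z *ᵥ (S *ᵥ b) - Z *ᵥ (S *ᵥ (b - v)) = Z *ᵥ (S *ᵥ v) := by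
      rw [← mulVec_sub, ← mulVec_sub, sub_sub_cancel]
    have e2 : l2 (Z *ᵥ (S *ᵥ (b - v))) = l2 (Z *ᵥ (S *ᵥ (v - b))) := by
      have : b - v = (-1 : ℝ) • (v - b) := by simp
      rw [this, mulVec_smul, mulVec_smul, l2_smul]
      simp
    rw [e1, e2] at hdiff
    have := mul_le_mul_of_nonneg_left hηC (Real.sqrt_nonneg (T : ℝ))
    linarith
  rcases eq_or_lt_of_le (l2_nonneg v) with h0 | hpos
  · rw [← h0]; simp [sq_nonneg]
  set w := (l2 v)⁻¹ • v with hw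
  have hw1 : l2 w = 1 := by
    rw [hw, l2_smul, abs_of_pos (inv_pos.2 hpos), inv_mul_cancel₀ hpos.ne']
  have hw0 : l0 w ≤ m := by
    refine (Finset.card_le_card fun k hk => ?_).trans hv
    rw [Finset.mem_filter] at hk ⊢
    exact ⟨hk.1, fun hc => hk.2 (by simp [hw, hc])⟩
  have h1 := hunit w hw0 hw1
  have h2 : l2 (Z *ᵥ (S *ᵥ v)) = l2 v * l2 (Z *ᵥ (S *ᵥ w)) := by
    have : v = l2 v • w := by rw [hw, smul_smul, mul_inv_cancel₀ hpos.ne', one_smul]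
    conv_lhs => rw [this]
    rw [mulVec_smul, mulVec_smul, l2_smul, abs_of_pos hpos]
  rw [h2, mul_pow]
  calc cS / 9 * l2 v ^ 2 * T = l2 v ^ 2 * (Real.sqrt T * (Real.sqrt cS / 3)) ^ 2 := by
        rw [mul_pow, div_pow, Real.sq_sqrt (Nat.cast_nonneg T), Real.sq_sqrt hcS.le]; ring
    _ ≤ _ := by gcongr

end Net

end PenalizedTS

/-! ### The two random events for the Gaussian design -/

namespace PenalizedTS

section Coefficients

variable {T p : ℕ}

/-- The coefficients of `∑ a t * w j * Z t j` in the joint family of Gaussian variables. -/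
def designCoef (a : Fin T → ℝ) (w : Fin p → ℝ) : (Fin T × Fin p) ⊕ Fin T → ℝ :=
  Sum.elim (fun ti => a ti.1 * w ti.2) fun _ => 0

/-- The coefficients of `∑ c t * z t` in the joint family of Gaussian variables. -/
def errCoef (c : Fin T → ℝ) : (Fin T × Fin p) ⊕ Fin T → ℝ := Sum.elim (fun _ => 0) c

theorem sum_designCoef_mul (a a' : Fin T → ℝ) (w w' : Fin p → ℝ) :
    ∑ k, designCoef a w k * designCoef a' w' k = (a ⬝ᵥ a') * (w ⬝ᵥ w') := by
  simp only [designCoef, Fintype.sum_sum_type, Sum.elim_inl, Sum.elim_inr, mul_zero,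
    Finset.sum_const_zero, add_zero, Fintype.sum_prod_type, dotProduct, Finset.sum_mul_sum]
  exact Finset.sum_congr rfl fun t _ => Finset.sum_congr rfl fun j _ => by ring

theorem sum_errCoef_mul (c c' : Fin T → ℝ) :
    ∑ k, errCoef (p := p) c k * errCoef c' k = c ⬝ᵥ c' := by
  simp [errCoef, Fintype.sum_sum_type, dotProduct]

theorem sum_designCoef_mul_errCoef (a : Fin T → ℝ) (w : Fin p → ℝ) (c : Fin T → ℝ) :
    ∑ k, designCoef a w k * errCoef c k = 0 := by
  simp [designCoef, errCoef, Fintype.sum_sum_type]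

theorem sum_designCoef_sq (a : Fin T → ℝ) (w : Fin p → ℝ) :
    ∑ k, designCoef a w k ^ 2 = (a ⬝ᵥ a) * (w ⬝ᵥ w) := by
  simp only [sq, sum_designCoef_mul]

theorem sum_errCoef_sq (c : Fin T → ℝ) : ∑ k, errCoef (p := p) c k ^ 2 = c ⬝ᵥ c := by
  simp only [sq, sum_errCoef_mul]

/-- Both sides are the squared Frobenius norm of `Aᵀ B`, by cyclicity of the trace: `tr (Bᵀ A Aᵀ B)
= tr (A Aᵀ B Bᵀ)`. -/
theorem sum_sq_transpose_mul (A B : Matrix (Fin T) (Fin T) ℝ) :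
    ∑ r, ∑ t, (∑ s, A s t * B s r) ^ 2 = ∑ s, ∑ t, (A s ⬝ᵥ A t) * (B s ⬝ᵥ B t) := by
  have h1 : ∑ r, ∑ t, (∑ s, A s t * B s r) ^ 2 = ((Aᵀ * B)ᵀ * (Aᵀ * B)).trace := by
    simp only [trace, diag_apply, mul_apply, transpose_apply, sq]
  have h2 : ∑ s, ∑ t, (A s ⬝ᵥ A t) * (B s ⬝ᵥ B t) = ((A * Aᵀ) * (B * Bᵀ)).trace := by
    simp only [trace, diag_apply, mul_apply, transpose_apply, dotProduct]
    exact Finset.sum_congr rfl fun s _ => Finset.sum_congr rfl fun t _ => by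
      congr 1
      exact Finset.sum_congr rfl fun r _ => mul_comm _ _
  rw [h1, h2, transpose_mul, transpose_transpose, Matrix.mul_assoc, trace_mul_comm]
  congr 1
  simp only [Matrix.mul_assoc]

end Coefficients

namespace Model

variable {Ω : Type*} {T p : ℕ}

/-- The joint family of the entries of `Z_X` and `z_u`. -/
def joint (M : Model Ω T p) (k : (Fin T × Fin p) ⊕ Fin T) (ω : Ω) : ℝ :=
  Sum.elim (fun ti => M.Z ω ti.1 ti.2) (fun t => M.z ω t) k

theorem lin_designCoef (M : Model Ω T p) (a : Fin T → ℝ) (w : Fin p → ℝ) (ω : Ω) :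
    lin M.joint (designCoef a w) ω = a ⬝ᵥ (M.Z ω *ᵥ w) := by
  simp only [lin, designCoef, joint, Fintype.sum_sum_type, Sum.elim_inl, Sum.elim_inr, zero_mul,
    Finset.sum_const_zero, add_zero, Fintype.sum_prod_type, dotProduct, mulVec, Finset.mul_sum]
  exact Finset.sum_congr rfl fun t _ => Finset.sum_congr rfl fun j _ => by ring

theorem lin_errCoef (M : Model Ω T p) (c : Fin T → ℝ) (ω : Ω) :
    lin M.joint (errCoef c) ω = c ⬝ᵥ M.z ω := by
  simp [lin, errCoef, joint, Fintype.sum_sum_type, dotProduct]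

/-- Together with `u_apply` this writes all data as linear forms in one Gaussian family, so moments
and independence reduce to dot products of coefficients. -/
theorem X_apply (M : Model Ω T p) (ω : Ω) (t : Fin T) (i : Fin p) :
    M.X ω t i = lin M.joint (designCoef (M.LX t) fun j => M.S j i) ω := by
  rw [lin_designCoef, X, Matrix.mul_assoc]
  rfl

theorem u_apply (M : Model Ω T p) (ω : Ω) (t : Fin T) :
    M.u ω t = lin M.joint (errCoef (M.sigma • M.Lu t)) ω := by
  rw [lin_errCoef, smul_dotProduct]
  rfl

variable {M : Model Ω T p} {cRX cRu cS K : ℝ}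

theorem l2_col_sq (M : Model Ω T p) (j : Fin p) : l2 (fun i => M.S i j) ^ 2 = M.colS j := l2_sq _

theorem IsRegular.one_le_colS (h : M.IsRegular cRX cRu cS K) (j : Fin p) : 1 ≤ M.colS j := by
  have := Finset.single_le_sum (f := fun i => M.S i j ^ 2) (fun _ _ => sq_nonneg _)
    (Finset.mem_univ j)
  simpa [h.diag_S j, colS] using this

theorem IsRegular.design_ge (h : M.IsRegular cRX cRu cS K) (hc : 0 < cRX) (ω : Ω)
    (v : Fin p → ℝ) : cRX * l2 (M.Z ω *ᵥ (M.S *ᵥ v)) ^ 2 ≤ l2 (M.X ω *ᵥ v) ^ 2 := by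
  have := l2_sq_mulVec_ge_of_posDef h.posDef_RX hc h.eig_RX (M.Z ω *ᵥ (M.S *ᵥ v))
  rwa [show M.X ω *ᵥ v = M.LX *ᵥ (M.Z ω *ᵥ (M.S *ᵥ v)) by
    simp only [X, mulVec_mulVec, Matrix.mul_assoc]]

variable [MeasurableSpace Ω] {P : Measure Ω}

theorem IsGaussian.isStdGaussian (h : M.IsGaussian P) : IsStdGaussian M.joint P where
  meas k := by
    rcases k with ti | t
    · exact h.measurable_Z ti.1 ti.2
    · exact h.measurable_z t
  law k := by
    rcases k with ti | t
    · exact h.law_Z ti.1 ti.2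
    · exact h.law_z t
  indep := h.indep

theorem IsGaussian.lintegral_exp_mulVec (h : M.IsGaussian P) (w : Fin p → ℝ) {c : ℝ}
    (hc : c * l2 w ^ 2 < 1 / 2) :
    ∫⁻ ω, ENNReal.ofReal (Real.exp (c * l2 (M.Z ω *ᵥ w) ^ 2)) ∂P
      = ENNReal.ofReal ((Real.sqrt (1 - 2 * (c * l2 w ^ 2)))⁻¹ ^ T) := by
  have h1 := h.isStdGaussian.lintegral_exp_sum_sq_lin
    (fun t : Fin T => designCoef (Pi.single t 1) w)
    (fun s t hst => by rw [sum_designCoef_mul]; simp [hst.symm])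
    (v := l2 w ^ 2) (fun t => by rw [sum_designCoef_sq, l2_sq_eq_dotProduct]; simp) hc
  simp only [lin_designCoef, single_one_dotProduct, Fintype.card_fin] at h1
  simpa only [l2_sq] using h1

theorem IsGaussian.measurable_mulVec (h : M.IsGaussian P) (w : Fin p → ℝ) :
    Measurable fun ω => l2 (M.Z ω *ᵥ w) ^ 2 := by
  simp only [l2_sq, mulVec, dotProduct]
  exact Finset.measurable_sum _ fun t _ =>
    (Finset.measurable_sum _ fun j _ => (h.measurable_Z t j).mul_const _).pow_const 2

/-- Chernoff bound with the exponent `-7/2`, optimal for the level `T / 8`, giving `8^{-T/2} exp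
(7T/16)`. With `log 8 / 2 ≥ 83/80` the rate is `83/80 - 7/16 = 3/5`, which has to exceed `1/2` to
beat the entropy of the net. -/
theorem IsGaussian.measure_mulVec_lt_le (h : M.IsGaussian P) (w : Fin p → ℝ) :
    P {ω | l2 (M.Z ω *ᵥ w) ^ 2 < (T : ℝ) / 8 * l2 w ^ 2}
      ≤ ENNReal.ofReal (Real.exp (-(3 / 5 * T))) := by
  rcases eq_or_lt_of_le (sq_nonneg (l2 w)) with h0 | hpos
  · have : {ω | l2 (M.Z ω *ᵥ w) ^ 2 < (T : ℝ) / 8 * l2 w ^ 2} = ∅ := by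
      ext ω
      simp only [Set.mem_ofPred_eq, Set.mem_empty_iff_false, iff_false, not_lt, ← h0, mul_zero]
      exact sq_nonneg _
    rw [this, measure_empty]; exact zero_le
  have hcv : -(7 / 2) / l2 w ^ 2 * l2 w ^ 2 = -(7 / 2) := div_mul_cancel₀ _ hpos.ne'
  have hint := (h.lintegral_exp_mulVec w (c := -(7 / 2) / l2 w ^ 2)
    (by rw [hcv]; norm_num)).le
  rw [hcv] at hint
  have hmk := exp_markov ((h.measurable_mulVec w).const_mul _) hint (-(7 / 16 * T))
  refine (measure_mono fun ω hω => ?_).trans (hmk.trans (ENNReal.ofReal_le_ofReal ?_))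
  · have hω' : l2 (M.Z ω *ᵥ w) ^ 2 < (T : ℝ) / 8 * l2 w ^ 2 := hω
    change -(7 / 16 * (T : ℝ)) ≤ -(7 / 2) / l2 w ^ 2 * l2 (M.Z ω *ᵥ w) ^ 2
    have e1 : -(7 / 2) / l2 w ^ 2 * l2 (M.Z ω *ᵥ w) ^ 2
        = -(7 / 2 * l2 (M.Z ω *ᵥ w) ^ 2) / l2 w ^ 2 := by ring
    rw [e1, le_div_iff₀ hpos]
    linarith
  · have h8 : (Real.sqrt (1 - 2 * -(7 / 2)))⁻¹ ≤ Real.exp (-(83 / 80)) := by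
      rw [Real.exp_neg]
      refine inv_anti₀ (Real.exp_pos _) (Real.le_sqrt_of_sq_le ?_)
      rw [← Real.exp_nat_mul]
      have hlog : Real.log 8 = 3 * Real.log 2 := by
        rw [show (8 : ℝ) = 2 ^ 3 by norm_num, Real.log_pow]; norm_num
      have := Real.log_two_gt_d9
      rw [← Real.le_log_iff_exp_le (by norm_num)]
      norm_num
      rw [hlog]
      linarith
    calc (Real.sqrt (1 - 2 * -(7 / 2)))⁻¹ ^ T * Real.exp (- -(7 / 16 * T))
        ≤ Real.exp (-(83 / 80)) ^ T * Real.exp (- -(7 / 16 * T)) := by gcongr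
      _ = Real.exp (-(3 / 5 * T)) := by
        rw [← Real.exp_nat_mul, ← Real.exp_add]; congr 1; ring

theorem IsGaussian.measure_le_mulVec_le (h : M.IsGaussian P) {w : Fin p → ℝ} (hw : 0 < l2 w) :
    P {ω | 8 * T * l2 w ^ 2 ≤ l2 (M.Z ω *ᵥ w) ^ 2} ≤ ENNReal.ofReal (Real.exp (-T)) := by
  have hpos : 0 < l2 w ^ 2 := by positivity
  have hcv : 1 / 4 / l2 w ^ 2 * l2 w ^ 2 = 1 / 4 := div_mul_cancel₀ _ hpos.ne'
  have hint := (h.lintegral_exp_mulVec w (c := 1 / 4 / l2 w ^ 2)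
    (by rw [hcv]; norm_num)).le
  rw [hcv] at hint
  have hmk := exp_markov ((h.measurable_mulVec w).const_mul _) hint (2 * T)
  refine (measure_mono fun ω hω => ?_).trans (hmk.trans (ENNReal.ofReal_le_ofReal ?_))
  · have hω' : 8 * T * l2 w ^ 2 ≤ l2 (M.Z ω *ᵥ w) ^ 2 := hω
    change 2 * (T : ℝ) ≤ 1 / 4 / l2 w ^ 2 * l2 (M.Z ω *ᵥ w) ^ 2
    rw [div_mul_eq_mul_div, le_div_iff₀ hpos]
    linarith
  · have h2 : (Real.sqrt (1 - 2 * (1 / 4)))⁻¹ ≤ Real.exp 1 := by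
      rw [← Real.sqrt_inv]
      refine Real.sqrt_le_iff.2 ⟨(Real.exp_pos _).le, ?_⟩
      have := Real.add_one_le_exp 2
      norm_num
      linarith
    calc (Real.sqrt (1 - 2 * (1 / 4)))⁻¹ ^ T * Real.exp (-(2 * T))
        ≤ Real.exp 1 ^ T * Real.exp (-(2 * T)) := by gcongr
      _ = Real.exp (-T) := by
        rw [← Real.exp_nat_mul, ← Real.exp_add]; congr 1; ring

/-- The probability that the design violates the sparse eigenvalue condition. -/
theorem measure_not_sparse_eigenvalue_le (hG : M.IsGaussian P) (h : M.IsRegular cRX cRu cS K)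
    (hcRX : 0 < cRX) (hcS : 0 < cS) {m N : ℕ} (hp : 0 < p) (hN : 0 < N) {η : ℝ}
    (hη : (m : ℝ) / N ≤ η)
    (hηK : Real.sqrt cS / 3 ≤ Real.sqrt (cS / 8) * (1 - η) - η * Real.sqrt (8 * K)) :
    P {ω | ¬ ∀ v : Fin p → ℝ, l0 v ≤ m →
        cRX * cS / 9 * l2 v ^ 2 * T ≤ l2 (M.X ω *ᵥ v) ^ 2}
      ≤ ENNReal.ofReal ((p * (2 * N + 1)) ^ m * Real.exp (-(3 / 5 * T)) + p * Real.exp (-T)) := by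
  set E1 := ⋃ b ∈ sparseNet p (grid N) m,
    {ω | l2 (M.Z ω *ᵥ (M.S *ᵥ b)) ^ 2 < (T : ℝ) / 8 * l2 (M.S *ᵥ b) ^ 2} with hE1
  set E2 := ⋃ j ∈ (Finset.univ : Finset (Fin p)),
    {ω | 8 * T * l2 (fun i => M.S i j) ^ 2 ≤ l2 (M.Z ω *ᵥ fun i => M.S i j) ^ 2} with hE2
  have hsub : {ω | ¬ ∀ v : Fin p → ℝ, l0 v ≤ m →
      cRX * cS / 9 * l2 v ^ 2 * T ≤ l2 (M.X ω *ᵥ v) ^ 2} ⊆ E1 ∪ E2 := by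
    intro ω hω
    by_contra hcon
    rw [Set.mem_union, not_or] at hcon
    obtain ⟨h1, h2⟩ := hcon
    simp only [hE1, Set.mem_iUnion, Set.mem_ofPred_eq, exists_prop, not_exists, not_and,
      not_lt] at h1
    simp only [hE2, Set.mem_iUnion, Set.mem_ofPred_eq, Finset.mem_univ, exists_prop, true_and,
      not_exists, not_le] at h2
    refine hω fun v hv => ?_
    have h3 := sparse_eigenvalue_of_net hp hN (T := T) (Z := M.Z ω) (S := M.S) hcS
      (Real.sqrt_nonneg (8 * K)) (l2_sq_mulVec_ge h.posDef_SigmaX.isHermitian h.eig_SigmaX) hη hηK h1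
      (fun j => by
        rw [← Real.sqrt_mul (Nat.cast_nonneg T)]
        refine Real.le_sqrt_of_sq_le ((h2 j).le.trans ?_)
        rw [l2_col_sq]
        have := mul_le_mul_of_nonneg_left (h.col_le j) (by positivity : (0 : ℝ) ≤ 8 * T)
        linarith) v hv
    calc cRX * cS / 9 * l2 v ^ 2 * T = cRX * (cS / 9 * l2 v ^ 2 * T) := by ring
      _ ≤ cRX * l2 (M.Z ω *ᵥ (M.S *ᵥ v)) ^ 2 := by gcongr
      _ ≤ _ := h.design_ge hcRX ω v
  have hP1 : P E1 ≤ ENNReal.ofReal ((p * (2 * N + 1)) ^ m * Real.exp (-(3 / 5 * T))) := by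
    refine (measure_biUnion_finset_le _ _).trans ?_
    refine (Finset.sum_le_card_nsmul _ _ _ fun b _ => hG.measure_mulVec_lt_le _).trans ?_
    rw [nsmul_eq_mul, ← ENNReal.ofReal_natCast, ← ENNReal.ofReal_mul (Nat.cast_nonneg _)]
    refine ENNReal.ofReal_le_ofReal (mul_le_mul_of_nonneg_right ?_ (Real.exp_pos _).le)
    have h1 := (card_sparseNet_le p (grid N) m).trans
      (Nat.pow_le_pow_left (Nat.mul_le_mul_left p (card_grid_le N)) m)
    exact_mod_cast h1
  have hP2 : P E2 ≤ ENNReal.ofReal (p * Real.exp (-T)) := by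
    refine (measure_biUnion_finset_le _ _).trans ?_
    refine (Finset.sum_le_card_nsmul _ _ _ fun j _ => hG.measure_le_mulVec_le ?_).trans ?_
    · have h1 := h.one_le_colS j
      rw [← l2_col_sq] at h1
      by_contra! hneg
      have : l2 (fun i => M.S i j) = 0 := le_antisymm hneg (l2_nonneg _)
      rw [this] at h1
      norm_num at h1
    rw [nsmul_eq_mul, ← ENNReal.ofReal_natCast, ← ENNReal.ofReal_mul (Nat.cast_nonneg _)]
    simp
  refine (measure_mono hsub).trans ((measure_union_le _ _).trans ((add_le_add hP1 hP2).trans ?_))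
  rw [← ENNReal.ofReal_add (by positivity) (by positivity)]

/-- Under the martingale difference condition `R_X` and `R_u` have no common nonzero entries off
the diagonal. -/
theorem IsMDS.dotProduct_mul_dotProduct_eq_zero [IsProbabilityMeasure P] (hM : M.IsMDS P) (hG : M.IsGaussian P)
    (h : M.IsRegular cRX cRu cS K) (i : Fin p) {s t : Fin T} (hst : s < t) :
    (M.LX s ⬝ᵥ M.LX t) * (M.Lu s ⬝ᵥ M.Lu t) = 0 := by
  have hW := hG.isStdGaussian
  set a : Fin T → (Fin T × Fin p) ⊕ Fin T → ℝ := fun t => designCoef (M.LX t) fun j => M.S j i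
    with ha
  set c : Fin T → (Fin T × Fin p) ⊕ Fin T → ℝ := fun t => errCoef (M.sigma • M.Lu t) with hc
  have hx : ∀ t, (fun ω => M.X ω t i) = lin M.joint (a t) := fun t =>
    funext fun ω => X_apply M ω t i
  have hu : ∀ t, (fun ω => M.u ω t) = lin M.joint (c t) := fun t =>
    funext fun ω => u_apply M ω t
  have hind : IndepFun (fun ω => lin M.joint (a s) ω * lin M.joint (a t) ω)
      (fun ω => lin M.joint (c s) ω * lin M.joint (c t) ω) P :=
    (hW.indepFun_lin a c fun s t => sum_designCoef_mul_errCoef _ _ _).comp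
      (φ := fun x : Fin T → ℝ => x s * x t) (ψ := fun x : Fin T → ℝ => x s * x t)
      (by fun_prop) (by fun_prop)
  have hiX : Integrable (fun ω => lin M.joint (a s) ω * lin M.joint (a t) ω) P :=
    (hW.hasGaussianLaw_lin (a s)).memLp_two.integrable_mul (hW.hasGaussianLaw_lin (a t)).memLp_two
  have hiU : Integrable (fun ω => lin M.joint (c s) ω * lin M.joint (c t) ω) P :=
    (hW.hasGaussianLaw_lin (c s)).memLp_two.integrable_mul (hW.hasGaussianLaw_lin (c t)).memLp_two
  set D : Fin T → Ω → ℝ := fun t ω => M.X ω t i * M.u ω t with hD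
  have hprod : D s * D t = fun ω => (lin M.joint (a s) ω * lin M.joint (a t) ω) *
      (lin M.joint (c s) ω * lin M.joint (c t) ω) := by
    ext ω
    simp only [Pi.mul_apply, hD, X_apply, u_apply, ha, hc]
    ring
  have hint : Integrable (D s * D t) P := by
    rw [hprod]
    exact hind.integrable_mul hiX hiU
  -- The design and the errors are independent, so the expectation factors into their covariances.
  -- The martingale property makes it vanish, and `colS` and `sigma` are positive.
  have hval : ∫ ω, (D s * D t) ω ∂P = (M.LX s ⬝ᵥ M.LX t) * M.colS i *
      (M.sigma ^ 2 * (M.Lu s ⬝ᵥ M.Lu t)) := by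
    rw [hprod, hind.integral_fun_mul_eq_mul_integral hiX.aestronglyMeasurable
      hiU.aestronglyMeasurable, hW.integral_lin_mul_lin, hW.integral_lin_mul_lin,
      sum_designCoef_mul, sum_errCoef_mul, ← l2_sq_eq_dotProduct, l2_col_sq, smul_dotProduct,
      dotProduct_smul, smul_eq_mul, smul_eq_mul]
    ring
  obtain ⟨ℱ, hℱ⟩ := hM i
  have hmeas : StronglyMeasurable[ℱ (t : ℕ)] (D s) :=
    (hℱ s).1.mono (ℱ.mono (Nat.succ_le_of_lt hst))
  have hcond : P[D s * D t | ℱ (t : ℕ)] =ᵐ[P] 0 := by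
    refine (condExp_mul_of_stronglyMeasurable_left hmeas hint (hℱ t).2.1).trans ?_
    filter_upwards [(hℱ t).2.2] with ω hω
    rw [Pi.mul_apply, hω]
    simp
  have hzero : ∫ ω, (D s * D t) ω ∂P = 0 := by
    rw [← integral_condExp (ℱ.le t), integral_congr_ae hcond]
    simp
  rw [hval] at hzero
  have h1 := h.one_le_colS i
  have h2 := h.sigma_pos
  have h3 : M.colS i * M.sigma ^ 2 ≠ 0 := by positivity
  refine (mul_eq_zero.1 (?_ : (M.colS i * M.sigma ^ 2) *
    ((M.LX s ⬝ᵥ M.LX t) * (M.Lu s ⬝ᵥ M.Lu t)) = 0)).resolve_left h3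
  rw [← hzero]; ring

/-- The probability that the noise in one covariate exceeds `x`. -/
theorem measure_noise_ge_le [IsProbabilityMeasure P] (hM : M.IsMDS P) (hG : M.IsGaussian P)
    (h : M.IsRegular cRX cRu cS K) (hT : 0 < T) (i : Fin p) (x : ℝ) :
    P {ω | x ≤ |∑ t, M.X ω t i * M.u ω t|}
      ≤ ENNReal.ofReal (3 * Real.exp (-((Real.sqrt (2 * (M.sigma ^ 2 * K ^ 3 * T)))⁻¹ * x))) := by
  have hW := hG.isStdGaussian
  have hK : 1 ≤ K := (h.one_le_colS i).trans (h.col_le i)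
  have hσ := h.sigma_pos
  have hT' : (0 : ℝ) < T := by exact_mod_cast hT
  -- Expanding `u` in the independent `z r` leaves as the factor of `z r` a linear form in `Z`
  -- alone: a decoupled chaos.
  set b : Fin T → (Fin T × Fin p) ⊕ Fin T → ℝ := fun r =>
    designCoef (fun t => M.sigma * ∑ s, M.LX s t * M.Lu s r) fun j => M.S j i with hb
  set e : Fin T → (Fin T × Fin p) ⊕ Fin T → ℝ := fun r => errCoef (Pi.single r 1) with he
  have hsum : ∀ ω, ∑ t, M.X ω t i * M.u ω t = ∑ r, lin M.joint (b r) ω * lin M.joint (e r) ω := by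
    intro ω
    simp only [X_apply, u_apply, hb, he, lin_designCoef, lin_errCoef, single_one_dotProduct]
    simp only [dotProduct, Pi.smul_apply, smul_eq_mul, Finset.mul_sum,
      Finset.sum_mul]
    rw [Finset.sum_comm]
    refine Finset.sum_congr rfl fun r _ => ?_
    rw [Finset.sum_comm]
    exact Finset.sum_congr rfl fun t _ => Finset.sum_congr rfl fun s _ => by ring
  -- The variance is `σ²` times `colS i` times `tr (R_X R_u)`. Only the diagonal terms survive, one
  -- per observation, whence linear growth in `T`.
  have hV : ∑ r, ∑ k, b r k ^ 2 ≤ M.sigma ^ 2 * K ^ 3 * T := by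
    have h1 : ∀ r, ∑ k, b r k ^ 2
        = M.sigma ^ 2 * M.colS i * ∑ t, (∑ s, M.LX s t * M.Lu s r) ^ 2 := fun r => by
      rw [hb, sum_designCoef_sq, ← l2_sq_eq_dotProduct, ← l2_sq_eq_dotProduct, l2_col_sq, l2_sq,
        mul_comm, Finset.mul_sum, Finset.mul_sum]
      exact Finset.sum_congr rfl fun t _ => by ring
    have h2 : ∑ s, ∑ t, (M.LX s ⬝ᵥ M.LX t) * (M.Lu s ⬝ᵥ M.Lu t) = ∑ s, M.rowX s * M.rowU s := by
      refine Finset.sum_congr rfl fun s _ => ?_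
      rw [Finset.sum_eq_single s]
      · rw [← l2_sq_eq_dotProduct, ← l2_sq_eq_dotProduct, l2_sq, l2_sq]
        rfl
      · intro t _ hts
        rcases lt_or_gt_of_ne hts with hlt | hlt
        · rw [dotProduct_comm, dotProduct_comm (M.Lu s)]
          exact hM.dotProduct_mul_dotProduct_eq_zero hG h i hlt
        · exact hM.dotProduct_mul_dotProduct_eq_zero hG h i hlt
      · simp
    have h3 : ∑ s, M.rowX s * M.rowU s ≤ T * K ^ 2 := by
      have : ∀ s ∈ Finset.univ, M.rowX s * M.rowU s ≤ K ^ 2 := fun s _ => by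
        have hs := h.row_le s
        have h0 : 0 ≤ M.rowU s := Finset.sum_nonneg fun _ _ => sq_nonneg _
        rw [sq]
        exact mul_le_mul ((le_max_left _ _).trans hs) ((le_max_right _ _).trans hs) h0
          (by linarith)
      simpa using Finset.sum_le_card_nsmul _ _ _ this
    rw [Finset.sum_congr rfl fun r _ => h1 r, ← Finset.mul_sum, sum_sq_transpose_mul, h2]
    calc M.sigma ^ 2 * M.colS i * ∑ s, M.rowX s * M.rowU s
        ≤ M.sigma ^ 2 * K * (T * K ^ 2) := by
          have h4 := h.col_le i
          have h5 := h.one_le_colS i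
          have h6 : 0 ≤ (T : ℝ) * K ^ 2 := by positivity
          have h7 : M.sigma ^ 2 * M.colS i ≤ M.sigma ^ 2 * K :=
            mul_le_mul_of_nonneg_left h4 (sq_nonneg _)
          exact (mul_le_mul_of_nonneg_left h3 (by positivity)).trans
            (mul_le_mul_of_nonneg_right h7 h6)
      _ = _ := by ring
  have hVpos : 0 < M.sigma ^ 2 * K ^ 3 * T := by positivity
  have key := hW.measure_chaos_ge_le b e (fun s t => sum_designCoef_mul_errCoef _ _ _)
    (fun s t hst => by rw [he, sum_errCoef_mul]; simp [hst.symm])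
    (fun t => by rw [he, sum_errCoef_sq]; simp)
    (θ := (Real.sqrt (2 * (M.sigma ^ 2 * K ^ 3 * T)))⁻¹) (by positivity) hV
    (by
      rw [inv_pow, Real.sq_sqrt (by positivity), mul_inv, mul_assoc, inv_mul_cancel₀ hVpos.ne']
      norm_num) x
  simpa only [hsum] using key

theorem measure_exists_noise_ge_le [IsProbabilityMeasure P] (hM : M.IsMDS P) (hG : M.IsGaussian P)
    (h : M.IsRegular cRX cRu cS K) (hT : 0 < T) (x : ℝ) :
    P {ω | ¬ ∀ i, |∑ t, M.X ω t i * M.u ω t| ≤ x}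
      ≤ ENNReal.ofReal
        (p * (3 * Real.exp (-((Real.sqrt (2 * (M.sigma ^ 2 * K ^ 3 * T)))⁻¹ * x)))) := by
  have hsub : {ω | ¬ ∀ i, |∑ t, M.X ω t i * M.u ω t| ≤ x} ⊆
      ⋃ i ∈ (Finset.univ : Finset (Fin p)), {ω | x ≤ |∑ t, M.X ω t i * M.u ω t|} := by
    intro ω hω
    obtain ⟨i, hi⟩ := not_forall.1 (show ¬ ∀ i, _ from hω)
    simp only [Finset.mem_univ, Set.iUnion_true, Set.mem_iUnion, Set.mem_ofPred_eq]
    exact ⟨i, (not_le.1 hi).le⟩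
  refine (measure_mono hsub).trans ((measure_biUnion_finset_le _ _).trans ?_)
  refine (Finset.sum_le_card_nsmul _ _ _ fun i _ => measure_noise_ge_le hM hG h hT i x).trans ?_
  rw [nsmul_eq_mul, ← ENNReal.ofReal_natCast, ← ENNReal.ofReal_mul (Nat.cast_nonneg _)]
  simp

end Model

end PenalizedTS

/-! ### The probability bound for fixed dimensions -/

namespace PenalizedTS

section Assembly

variable {Ω : Type*} [MeasurableSpace Ω] {P : Measure Ω} {T p : ℕ} {M : Model Ω T p}

theorem l0_sub_le (a b : Fin p → ℝ) : l0 (a - b) ≤ l0 a + l0 b := by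
  refine (Finset.card_le_card fun j hj => ?_).trans (Finset.card_union_le _ _)
  rw [Finset.mem_union, Finset.mem_filter, Finset.mem_filter]
  by_contra hc
  push Not at hc
  exact (Finset.mem_filter.1 hj).2
    (by simp [hc.1 (Finset.mem_univ j), hc.2 (Finset.mem_univ j)])

namespace Model

theorem IsGaussian.measurable_objective (hG : M.IsGaussian P) {q : ℝ → ℝ} {lam μ : ℝ}
    (hq : IsFoldedConcave q lam μ) (b : Fin p → ℝ) : Measurable fun ω => M.Q q ω b := by
  have hX : ∀ t i, Measurable fun ω => M.X ω t i := fun t i => by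
    simp only [X_apply]
    exact hG.isStdGaussian.measurable_lin _
  have hu : ∀ t, Measurable fun ω => M.u ω t := fun t => by
    simp only [u_apply]
    exact hG.isStdGaussian.measurable_lin _
  have hXv : ∀ (v : Fin p → ℝ) t, Measurable fun ω => (M.X ω *ᵥ v) t := fun v t => by
    simp only [mulVec, dotProduct]
    exact Finset.measurable_sum _ fun i _ => (hX t i).mul_const _
  have hQ : ∀ ω, M.Q q ω b = (2 * (T : ℝ))⁻¹ * (∑ t, (M.y ω t - (M.X ω *ᵥ b) t) ^ 2)
      + ∑ j, q |b j| := fun ω => objective_eq hq (M.X ω) (M.y ω) b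
  simp only [hQ]
  refine (Measurable.const_mul (Finset.measurable_sum _ fun t _ => Measurable.pow_const ?_ 2)
    _).add_const _
  exact ((hXv M.beta0 t).add (hu t)).sub (hXv b t)

/-- A measurable selection of global minimizers of the penalized objective over the sparse
vectors. -/
theorem IsGaussian.exists_measurable_minimizer (hG : M.IsGaussian P) (hT : 0 < T) {q : ℝ → ℝ}
    {lam μ : ℝ} (hq : IsFoldedConcave q lam μ) (k : ℕ) :
    ∃ β : Ω → Fin p → ℝ, Measurable β ∧
      ∀ ω, l0 (β ω) ≤ k ∧ ∀ b, l0 b ≤ k → M.Q q ω (β ω) ≤ M.Q q ω b :=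
  exists_measurable_argmin (isClosed_sparse k) (fun b => hG.measurable_objective hq b)
    (fun ω => continuous_objective hq (M.X ω) (M.y ω))
    fun ω => exists_min_sparse hq hT (M.X ω) (M.y ω) k

/-- The error bounds for fixed dimensions, under numerical conditions on them. -/
theorem exists_local_minimizer [IsProbabilityMeasure P] (hT : 0 < T) (hp : 0 < p)
    {cRX cRu cS K : ℝ} (hcRX : 0 < cRX) (hcS : 0 < cS)
    (hG : M.IsGaussian P) (hR : M.IsRegular cRX cRu cS K) (hM : M.IsMDS P) {s m N : ℕ}
    (hs : l0 M.beta0 = s) (hsm : 2 * s ≤ m) {q : ℝ → ℝ} {lam μ γ : ℝ}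
    (hq : IsFoldedConcave q lam μ) (hlam : 0 < lam) (hγ : γ = cS * min cRX cRu / 9)
    (hγμ : μ / 2 < γ) (hN : 0 < N) {η : ℝ} (hη : (m : ℝ) / N ≤ η)
    (hηK : Real.sqrt cS / 3 ≤ Real.sqrt (cS / 8) * (1 - η) - η * Real.sqrt (8 * K))
    (hnoise : p * (3 * Real.exp (-((Real.sqrt (2 * (M.sigma ^ 2 * K ^ 3 * T)))⁻¹ * (lam / 4 * T))))
      ≤ 3 * (p : ℝ)⁻¹)
    (hnet : ((p : ℝ) * (2 * N + 1)) ^ m * Real.exp (-(3 / 5 * T)) ≤ (p : ℝ)⁻¹)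
    (hcol : (p : ℝ) * Real.exp (-T) ≤ (p : ℝ)⁻¹) :
    ∃ β : Ω → Fin p → ℝ, Measurable β ∧
      (∀ ω, l0 (β ω) ≤ m - s ∧ IsLocalMinOn (M.Q q ω) {b | l0 b ≤ m - s} (β ω)) ∧
      1 - 5 * (p : ℝ)⁻¹ ≤ P.real {ω |
        l2 (β ω - M.beta0) ≤ 6 * Real.sqrt s * lam / (2 * γ - μ) ∧
        l1 (β ω - M.beta0) ≤ 24 * (s : ℝ) * lam / (2 * γ - μ) ∧
        (Real.sqrt T)⁻¹ * l2 (M.X ω *ᵥ (β ω - M.beta0)) ≤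
          9 * Real.sqrt s * lam / Real.sqrt (2 * γ - μ)} := by
  obtain ⟨β, hβ, hmin⟩ := hG.exists_measurable_minimizer hT hq (m - s)
  refine ⟨β, hβ, fun ω => ⟨(hmin ω).1, IsMinOn.localize fun b hb => (hmin ω).2 b hb⟩, ?_⟩
  set A := {ω | ¬ ∀ i, |∑ t, M.X ω t i * M.u ω t| ≤ lam / 4 * T} with hA
  set B := {ω | ¬ ∀ v : Fin p → ℝ, l0 v ≤ m →
    cRX * cS / 9 * l2 v ^ 2 * T ≤ l2 (M.X ω *ᵥ v) ^ 2} with hB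
  set G := {ω |
        l2 (β ω - M.beta0) ≤ 6 * Real.sqrt s * lam / (2 * γ - μ) ∧
        l1 (β ω - M.beta0) ≤ 24 * (s : ℝ) * lam / (2 * γ - μ) ∧
        (Real.sqrt T)⁻¹ * l2 (M.X ω *ᵥ (β ω - M.beta0)) ≤
          9 * Real.sqrt s * lam / Real.sqrt (2 * γ - μ)} with hGdef
  -- Covering the whole space bounds the probability of `G` from below by subadditivity alone.
  have hcover : (Set.univ : Set Ω) ⊆ G ∪ (A ∪ B) := by
    intro ω _
    by_contra hcon
    rw [Set.mem_union, Set.mem_union, not_or, not_or] at hcon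
    obtain ⟨h1, h2, h3⟩ := hcon
    have h2' : ∀ i, |∑ t, M.X ω t i * M.u ω t| ≤ lam / 4 * T := not_not.1 h2
    have h3' : ∀ v : Fin p → ℝ, l0 v ≤ m →
      cRX * cS / 9 * l2 v ^ 2 * T ≤ l2 (M.X ω *ᵥ v) ^ 2 := not_not.1 h3
    refine h1 (oracle_bounds hT hq hlam hγμ (M.X ω) (M.u ω) M.beta0 (β ω) hs
      ((hmin ω).2 M.beta0 (by omega)) h2' ?_)
    have hsp : l0 (β ω - M.beta0) ≤ m := by
      have := l0_sub_le (β ω) M.beta0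
      have := (hmin ω).1
      omega
    refine le_trans ?_ (h3' _ hsp)
    have : γ ≤ cRX * cS / 9 := by
      rw [hγ, mul_comm cRX]
      have := min_le_left cRX cRu
      gcongr
    gcongr
  have hPA : P.real A ≤ 3 * (p : ℝ)⁻¹ :=
    ENNReal.toReal_le_of_le_ofReal (by positivity)
      ((measure_exists_noise_ge_le hM hG hR hT _).trans (ENNReal.ofReal_le_ofReal hnoise))
  have hPB : P.real B ≤ 2 * (p : ℝ)⁻¹ :=
    ENNReal.toReal_le_of_le_ofReal (by positivity)
      ((measure_not_sparse_eigenvalue_le hG hR hcRX hcS hp hN hη hηK).trans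
        (ENNReal.ofReal_le_ofReal (by linarith)))
  have h1 : P.real Set.univ ≤ P.real (G ∪ (A ∪ B)) := measureReal_mono hcover
  rw [probReal_univ] at h1
  have h2 := measureReal_union_le (μ := P) G (A ∪ B)
  have h3 := measureReal_union_le (μ := P) A B
  linarith

end Model

end Assembly

/-! ### Asymptotics of the dimensions -/

section Asymptotics

theorem tendsto_dimension {φ δ : ℝ} (hφ : 0 < φ) (hδ : 0 < δ) {p : ℕ → ℕ}
    (hp : ∀ᶠ T : ℕ in atTop, |(p T : ℝ) - Real.exp (φ * (T : ℝ) ^ δ)| < 1) :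
    Tendsto (fun T => (p T : ℝ)) atTop atTop := by
  have h1 : Tendsto (fun T : ℕ => Real.exp (φ * (T : ℝ) ^ δ) - 1) atTop atTop :=
    tendsto_atTop_add_const_right _ _ (Real.tendsto_exp_atTop.comp
      (((tendsto_rpow_atTop hδ).comp tendsto_natCast_atTop_atTop).const_mul_atTop hφ))
  refine tendsto_atTop_mono' _ ?_ h1
  filter_upwards [hp] with T hT
  have := (abs_lt.1 hT).1
  linarith

/-- Rounding at most doubles `exp (φ x) ≥ 1`, which costs `log 2`. -/
theorem log_dimension_le {φ x : ℝ} (hφ : 0 < φ) (hx : 0 ≤ x) {p : ℝ} (hp0 : 0 < p)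
    (hp : |p - Real.exp (φ * x)| < 1) : Real.log p ≤ φ * x + Real.log 2 := by
  have h1 : 1 ≤ Real.exp (φ * x) := Real.one_le_exp (by positivity)
  have h2 := (abs_lt.1 hp).2
  calc Real.log p ≤ Real.log (Real.exp (φ * x) * 2) := Real.log_le_log hp0 (by linarith)
    _ = _ := by rw [Real.log_mul (Real.exp_pos _).ne' two_ne_zero, Real.log_exp]

/-- These are the lower-order terms in the union bound over the net: the logarithm of the grid size
and the rounding loss, multiplied by the sparsity, plus `log p`. All are `o(x)` because `0 < δ < 1`.
-/
theorem eventually_remainder_le {φ δ : ℝ} (hδ : 0 < δ) (hδ1 : δ < 1) {ε : ℝ}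
    (hε : 0 < ε) :
    ∀ᶠ x : ℝ in atTop, φ * x ^ (1 - δ) * (Real.log 2 + Real.log 3 + 2 * Real.log x)
      + (φ * x ^ δ + Real.log 2) ≤ ε * x := by
  have h1 : Tendsto (fun x : ℝ => x ^ (-δ)) atTop (𝓝 0) := tendsto_rpow_neg_atTop hδ
  have h2 : Tendsto (fun x : ℝ => Real.log x / x ^ δ) atTop (𝓝 0) :=
    (isLittleO_log_rpow_atTop hδ).tendsto_div_nhds_zero
  have h3 : Tendsto (fun x : ℝ => x ^ (-(1 - δ))) atTop (𝓝 0) :=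
    tendsto_rpow_neg_atTop (by linarith)
  have h4 : Tendsto (fun x : ℝ => x⁻¹) atTop (𝓝 0) := tendsto_inv_atTop_zero
  have h5 := (((h1.const_mul (φ * (Real.log 2 + Real.log 3))).add (h2.const_mul (φ * 2))).add
    (h3.const_mul φ)).add (h4.const_mul (Real.log 2))
  simp only [mul_zero, add_zero] at h5
  filter_upwards [h5.eventually (gt_mem_nhds hε), eventually_gt_atTop 0] with x hx hx0
  have e1 : x ^ (1 - δ) = x * x ^ (-δ) := by
    rw [sub_eq_add_neg, Real.rpow_add hx0, Real.rpow_one]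
  have e2 : x ^ δ = x * x ^ (-(1 - δ)) := by
    rw [show -(1 - δ) = δ - 1 by ring, Real.rpow_sub_one hx0.ne']; field_simp
  have e3 : Real.log x / x ^ δ = Real.log x * x ^ (-δ) := by
    rw [Real.rpow_neg hx0.le, div_eq_mul_inv]
  rw [e3] at hx
  rw [e1, e2]
  have := mul_le_mul_of_nonneg_right hx.le hx0.le
  refine le_trans (le_of_eq ?_) this
  field_simp
  ring

/-- The size of the net of sparse vectors is at most `exp (3 T / 5) / p`. -/
theorem eventually_net_le {φ δ : ℝ} (hφ : 0 < φ) (hδ : 0 < δ) (hδ1 : δ < 1)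
    (hφ2 : φ ^ 2 < 1 / 2) {p m : ℕ → ℕ}
    (hp : ∀ᶠ T : ℕ in atTop, |(p T : ℝ) - Real.exp (φ * (T : ℝ) ^ δ)| < 1)
    (hm : ∀ᶠ T : ℕ in atTop, (m T : ℝ) ≤ φ * (T : ℝ) ^ (1 - δ)) :
    ∀ᶠ T : ℕ in atTop, ((p T : ℝ) * (2 * (T ^ 2 : ℕ) + 1)) ^ m T * Real.exp (-(3 / 5 * T))
      ≤ (p T : ℝ)⁻¹ := by
  -- The slack `1/10` is the difference between the rate `3/5` and the bound `1/2` on `φ²`.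
  have hrem := tendsto_natCast_atTop_atTop.eventually
    (eventually_remainder_le (φ := φ) hδ hδ1 (ε := 1 / 10) (by norm_num))
  filter_upwards [hp, hm, hrem, (tendsto_dimension hφ hδ hp).eventually_ge_atTop 1,
    eventually_ge_atTop 1] with T hp hm hrem hp1 hT
  have hT' : (1 : ℝ) ≤ T := by exact_mod_cast hT
  have hp0 : (0 : ℝ) < p T := by linarith
  have hlog := log_dimension_le hφ (by positivity) hp0 hp
  have hlogp0 : 0 ≤ Real.log (p T) := Real.log_nonneg hp1
  set x : ℝ := (T : ℝ) with hx
  have hx0 : 0 < x := by linarith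
  have hgrid : Real.log (2 * ((T ^ 2 : ℕ) : ℝ) + 1) ≤ Real.log 3 + 2 * Real.log x := by
    push_cast
    rw [← hx]
    calc Real.log (2 * x ^ 2 + 1) ≤ Real.log (3 * x ^ 2) :=
          Real.log_le_log (by positivity) (by nlinarith)
      _ = _ := by rw [Real.log_mul (by norm_num) (by positivity), Real.log_pow]; norm_num
  have hbase : 0 < (p T : ℝ) * (2 * ((T ^ 2 : ℕ) : ℝ) + 1) := by positivity
  have hlogbase : Real.log ((p T : ℝ) * (2 * ((T ^ 2 : ℕ) : ℝ) + 1))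
      ≤ φ * x ^ δ + (Real.log 2 + Real.log 3 + 2 * Real.log x) := by
    rw [Real.log_mul hp0.ne' (by positivity)]
    linarith
  have hbig : 0 ≤ Real.log ((p T : ℝ) * (2 * ((T ^ 2 : ℕ) : ℝ) + 1)) := by
    refine Real.log_nonneg ?_
    have : (0 : ℝ) ≤ ((T ^ 2 : ℕ) : ℝ) := Nat.cast_nonneg _
    nlinarith
  have hmul : (m T : ℝ) * Real.log ((p T : ℝ) * (2 * ((T ^ 2 : ℕ) : ℝ) + 1))
      ≤ φ ^ 2 * x + φ * x ^ (1 - δ) * (Real.log 2 + Real.log 3 + 2 * Real.log x) := by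
    calc _ ≤ φ * x ^ (1 - δ) * (φ * x ^ δ + (Real.log 2 + Real.log 3 + 2 * Real.log x)) :=
          mul_le_mul hm hlogbase hbig (by positivity)
      _ = φ ^ 2 * (x ^ (1 - δ) * x ^ δ)
          + φ * x ^ (1 - δ) * (Real.log 2 + Real.log 3 + 2 * Real.log x) := by ring
      _ = _ := by rw [← Real.rpow_add hx0, sub_add_cancel, Real.rpow_one]
  have hφx : φ ^ 2 * x ≤ 1 / 2 * x := mul_le_mul_of_nonneg_right hφ2.le hx0.le
  rw [← Real.exp_log (pow_pos hbase (m T)), Real.log_pow, ← Real.exp_add,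
    ← Real.exp_log (inv_pos.2 hp0), Real.log_inv]
  refine Real.exp_le_exp.2 ?_
  linarith

theorem eventually_col_le {φ δ : ℝ} (hφ : 0 < φ) (hδ : 0 < δ) (hδ1 : δ < 1) {p : ℕ → ℕ}
    (hp : ∀ᶠ T : ℕ in atTop, |(p T : ℝ) - Real.exp (φ * (T : ℝ) ^ δ)| < 1) :
    ∀ᶠ T : ℕ in atTop, (p T : ℝ) * Real.exp (-T) ≤ (p T : ℝ)⁻¹ := by
  have hrem := tendsto_natCast_atTop_atTop.eventually
    (eventually_remainder_le (φ := φ) hδ hδ1 (ε := 1 / 2) (by norm_num))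
  filter_upwards [hp, hrem, (tendsto_dimension hφ hδ hp).eventually_ge_atTop 1,
    eventually_ge_atTop 1] with T hp hrem hp1 hT
  have hT' : (1 : ℝ) ≤ T := by exact_mod_cast hT
  have hp0 : (0 : ℝ) < p T := by linarith
  have hlog := log_dimension_le hφ (by positivity) hp0 hp
  have h0 : 0 ≤ φ * (T : ℝ) ^ (1 - δ) * (Real.log 2 + Real.log 3 + 2 * Real.log T) := by
    have h1 := Real.log_nonneg hT'
    have h2 := Real.log_nonneg (by norm_num : (1 : ℝ) ≤ 2)
    have h3 := Real.log_nonneg (by norm_num : (1 : ℝ) ≤ 3)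
    positivity
  rw [← Real.exp_log (inv_pos.2 hp0), Real.log_inv]
  nth_rw 1 [← Real.exp_log hp0]
  rw [← Real.exp_add]
  refine Real.exp_le_exp.2 ?_
  linarith

/-- The exponent equals a constant times `√(log p) log (pT)`. Once the constant times `√(log p)`
reaches `2`, it is at least `2 log p`: one `log p` pays for the union over covariates, the other is
the final rate. -/
theorem eventually_noise_le {c0 κ : ℝ} (hc0 : 0 < c0) (hκ : 0 < κ) {p : ℕ → ℕ}
    (hp : Tendsto (fun T => (p T : ℝ)) atTop atTop) :
    ∀ᶠ T : ℕ in atTop, p T * (3 * Real.exp (-((Real.sqrt (2 * (κ * T)))⁻¹ *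
      (regParam c0 T (p T) / 4 * T)))) ≤ 3 * (p T : ℝ)⁻¹ := by
  have h1 : Tendsto (fun T => c0 / (4 * Real.sqrt (2 * κ)) * Real.sqrt (Real.log (p T))) atTop
      atTop :=
    (Real.tendsto_sqrt_atTop.comp (Real.tendsto_log_atTop.comp hp)).const_mul_atTop (by positivity)
  filter_upwards [h1.eventually_ge_atTop 2, hp.eventually_ge_atTop 1, eventually_ge_atTop 1]
    with T h2 hp1 hT
  have hT' : (1 : ℝ) ≤ T := by exact_mod_cast hT
  have hT0 : (0 : ℝ) < T := by linarith
  have hp0 : (0 : ℝ) < p T := by linarith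
  have hlogp : 0 ≤ Real.log (p T) := Real.log_nonneg hp1
  have hlog : Real.log (p T) ≤ Real.log ((p T : ℝ) * T) :=
    Real.log_le_log hp0 (le_mul_of_one_le_right hp0.le hT')
  have key : 2 * Real.log (p T) ≤ (Real.sqrt (2 * (κ * T)))⁻¹ *
      (regParam c0 T (p T) / 4 * T) := by
    have e1 : (Real.sqrt (2 * (κ * T)))⁻¹ * (regParam c0 T (p T) / 4 * T)
        = c0 / (4 * Real.sqrt (2 * κ)) * Real.sqrt (Real.log (p T)) *
          Real.log ((p T : ℝ) * T) := by
      rw [regParam, ← mul_assoc 2, Real.sqrt_mul (by positivity), Real.sqrt_div hlogp]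
      have h3 : Real.sqrt T * Real.sqrt T = T := Real.mul_self_sqrt hT0.le
      have h4 : Real.sqrt T ≠ 0 := (Real.sqrt_pos.2 hT0).ne'
      have h5 : Real.sqrt (2 * κ) ≠ 0 := (Real.sqrt_pos.2 (by positivity)).ne'
      field_simp
      rw [sq, h3]
    rw [e1]
    exact mul_le_mul h2 hlog hlogp (by linarith)
  have h6 : Real.exp (-((Real.sqrt (2 * (κ * T)))⁻¹ * (regParam c0 T (p T) / 4 * T)))
      ≤ (p T : ℝ)⁻¹ * (p T : ℝ)⁻¹ := by
    rw [← Real.exp_log (inv_pos.2 hp0), Real.log_inv, ← Real.exp_add]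
    exact Real.exp_le_exp.2 (by linarith)
  calc _ ≤ (p T : ℝ) * (3 * ((p T : ℝ)⁻¹ * (p T : ℝ)⁻¹)) := by gcongr
    _ = _ := by field_simp

theorem regParam_pos {c0 : ℝ} (hc0 : 0 < c0) {T p : ℕ} (hT : 0 < T) (hp : 2 ≤ p) :
    0 < regParam c0 T p := by
  have hT' : (1 : ℝ) ≤ T := by exact_mod_cast hT
  have hp' : (2 : ℝ) ≤ p := by exact_mod_cast hp
  have h1 : 0 < Real.log p := Real.log_pos (by linarith)
  have h2 : 0 < Real.log ((p : ℝ) * T) := Real.log_pos (by nlinarith)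
  have h3 : (0 : ℝ) < T := by linarith
  unfold regParam
  positivity

/-- The strict inequality `1/9 < 1/8` leaves room for a mesh tending to zero. -/
theorem eventually_mesh_le {cS K : ℝ} (hcS : 0 < cS) :
    ∀ᶠ T : ℕ in atTop, Real.sqrt cS / 3 ≤
      Real.sqrt (cS / 8) * (1 - 1 / (T : ℝ)) - 1 / (T : ℝ) * Real.sqrt (8 * K) := by
  have h1 : Tendsto (fun T : ℕ => 1 / (T : ℝ)) atTop (𝓝 0) := tendsto_one_div_atTop_nhds_zero_nat
  have h2 : Tendsto (fun T : ℕ => Real.sqrt (cS / 8) * (1 - 1 / (T : ℝ)) -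
      1 / (T : ℝ) * Real.sqrt (8 * K)) atTop
      (𝓝 (Real.sqrt (cS / 8) * (1 - 0) - 0 * Real.sqrt (8 * K))) :=
    ((h1.const_sub 1).const_mul _).sub (h1.mul_const _)
  refine h2.eventually (le_mem_nhds ?_)
  rw [sub_zero, mul_one, zero_mul, sub_zero]
  rw [show Real.sqrt cS / 3 = Real.sqrt (cS / 9) by
    rw [Real.sqrt_div hcS.le, show (9 : ℝ) = 3 ^ 2 by norm_num, Real.sqrt_sq (by norm_num)]]
  exact Real.sqrt_lt_sqrt (by positivity) (by linarith)

end Asymptotics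

end PenalizedTS

/-! ### The asymptotic statement -/

theorem corollary1
    {Ω : ℕ → Type*} [∀ T, MeasurableSpace (Ω T)]
    (P : ∀ T, Measure (Ω T)) [∀ T, IsProbabilityMeasure (P T)]
    -- dimensions: `p` and `s` agree with `exp (φ T^δ)` and `φ₀ T^δ₀` up to integer rounding
    (φ φ₀ δ δ₀ : ℝ) (hφ : 0 < φ) (hφ₀ : 0 < φ₀) (hδ : 0 < δ) (hδ₀ : 0 < δ₀)
    (hδδ₀ : δ + δ₀ < 1) (hφ2 : φ ^ 2 < 1 / 2)
    (p s m : ℕ → ℕ)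
    (hp : ∀ᶠ T : ℕ in atTop, |(p T : ℝ) - Real.exp (φ * (T : ℝ) ^ δ)| < 1)
    (hs : ∀ᶠ T : ℕ in atTop, |(s T : ℝ) - φ₀ * (T : ℝ) ^ δ₀| < 1)
    (hm : ∀ᶠ T : ℕ in atTop, (m T : ℝ) ≤ φ * (T : ℝ) ^ (1 - δ))
    (hsm : ∀ᶠ T : ℕ in atTop, 2 * s T ≤ m T)
    -- the regression models
    (M : ∀ T, PenalizedTS.Model (Ω T) T (p T))
    (σu cRX cRu cS K : ℝ) (hcRX : 0 < cRX) (hcRu : 0 < cRu) (hcS : 0 < cS)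
    (hσ : ∀ᶠ T : ℕ in atTop, (M T).sigma = σu)
    (hsparse : ∀ᶠ T : ℕ in atTop, PenalizedTS.l0 (M T).beta0 = s T)
    (hgauss : ∀ᶠ T : ℕ in atTop, (M T).IsGaussian (P T))
    (hreg : ∀ᶠ T : ℕ in atTop, (M T).IsRegular cRX cRu cS K)
    (hmds : ∀ᶠ T : ℕ in atTop, (M T).IsMDS (P T))
    -- the regularization parameter
    (c0 : ℝ) (hc0 : 0 < c0)
    (hc0_scale : 16 * limsup (fun T => (M T).scale) atTop ≤ ENNReal.ofReal c0)
    -- the penalty, `pen lam` being `p_λ`, and the restricted eigenvalue constant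
    (pen : ℝ → ℝ → ℝ) (μ γ : ℝ)
    (hpen : ∀ᶠ T : ℕ in atTop,
      PenalizedTS.IsFoldedConcave (pen (PenalizedTS.regParam c0 T (p T)))
        (PenalizedTS.regParam c0 T (p T)) μ)
    (hγ : γ = cS * min cRX cRu / 9) (hγμ : μ / 2 < γ) :
    ∀ᶠ T : ℕ in atTop,
      ∃ βhat : Ω T → (Fin (p T) → ℝ),
        Measurable βhat ∧
        (∀ ω, PenalizedTS.l0 (βhat ω) ≤ m T - s T ∧
          IsLocalMinOn ((M T).Q (pen (PenalizedTS.regParam c0 T (p T))) ω)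
            {b | PenalizedTS.l0 b ≤ m T - s T} (βhat ω)) ∧
        1 - 6 * ((p T : ℝ))⁻¹ - 2 * Real.exp (-((1 / 2 - φ ^ 2) * (T : ℝ))) ≤
          (P T).real {ω |
            PenalizedTS.l2 (βhat ω - (M T).beta0) ≤
              6 * Real.sqrt (s T) * PenalizedTS.regParam c0 T (p T) / (2 * γ - μ) ∧
            PenalizedTS.l1 (βhat ω - (M T).beta0) ≤
              24 * (s T : ℝ) * PenalizedTS.regParam c0 T (p T) / (2 * γ - μ) ∧
            (Real.sqrt T)⁻¹ * PenalizedTS.l2 ((M T).X ω *ᵥ (βhat ω - (M T).beta0)) ≤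
              9 * Real.sqrt (s T) * PenalizedTS.regParam c0 T (p T) /
                Real.sqrt (2 * γ - μ)} := by
  have hδ1 : δ < 1 := by linarith
  have hdim := PenalizedTS.tendsto_dimension hφ hδ hp
  have hK : 1 ≤ K ∧ 0 < σu := by
    obtain ⟨T, hR, hp1, hσT⟩ := (hreg.and ((hdim.eventually_ge_atTop 1).and hσ)).exists
    have hp0 : 0 < p T := by exact_mod_cast zero_lt_one.trans_le hp1
    exact ⟨(hR.one_le_colS ⟨0, hp0⟩).trans (hR.col_le _), hσT ▸ hR.sigma_pos⟩
  have hκ : 0 < σu ^ 2 * K ^ 3 := by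
    have h1 := hK.1
    have h2 := hK.2
    positivity
  -- With grid resolution `T²` and `m ≤ T`, the `ℓ₁` rounding error is at most `1 / T`, while the
  -- grid adds only `O(log T)` to the entropy per coordinate.
  have hmT : ∀ᶠ T : ℕ in atTop, (m T : ℝ) / (T ^ 2 : ℕ) ≤ 1 / T := by
    have h1 := ((tendsto_rpow_atTop hδ).comp tendsto_natCast_atTop_atTop).eventually_ge_atTop φ
    filter_upwards [hm, h1, eventually_ge_atTop 1] with T hm h1 hT
    have hT0 : (0 : ℝ) < T := by exact_mod_cast hT
    have h2 : (m T : ℝ) ≤ T := by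
      refine hm.trans ?_
      calc φ * (T : ℝ) ^ (1 - δ) ≤ (T : ℝ) ^ δ * (T : ℝ) ^ (1 - δ) := by gcongr; exact h1
        _ = T := by rw [← Real.rpow_add hT0, add_sub_cancel, Real.rpow_one]
    push_cast
    rw [div_le_div_iff₀ (by positivity) hT0]
    nlinarith
  filter_upwards [hsm, hσ, hsparse, hgauss, hreg, hmds, hpen, hmT,
    hdim.eventually_ge_atTop 2, eventually_ge_atTop 1,
    PenalizedTS.eventually_net_le hφ hδ hδ1 hφ2 hp hm, PenalizedTS.eventually_col_le hφ hδ hδ1 hp,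
    PenalizedTS.eventually_noise_le hc0 hκ hdim, PenalizedTS.eventually_mesh_le (K := K) hcS]
    with T hsm hσ hsparse hG hR hM hq hmT hp2 hT hnet hcol hnoise hmesh
  have hp2' : 2 ≤ p T := by exact_mod_cast hp2
  obtain ⟨β, hβ, hmin, hprob⟩ := PenalizedTS.Model.exists_local_minimizer hT (by omega) hcRX hcS
    hG hR hM hsparse hsm hq (PenalizedTS.regParam_pos hc0 hT hp2') hγ hγμ (N := T ^ 2)
    (by positivity) hmT hmesh (by rw [hσ]; exact hnoise) hnet hcol
  -- The failure probability obtained is `5 / p`, below the one allowed.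
  refine ⟨β, hβ, hmin, le_trans ?_ hprob⟩
  have h1 : 0 ≤ ((p T : ℝ))⁻¹ := by positivity
  have h2 : 0 ≤ 2 * Real.exp (-((1 / 2 - φ ^ 2) * (T : ℝ))) := by positivity
  linarith
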